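/- **Setting.** Let $\mathcal S,\mathcal A$ be finite nonempty sets, $\mathsf P=\{p^a_s\in\Delta(\mathcal S)\}$ a transition kernel, $c:\mathcal S\times\mathcal A\to[0,1]$ a cost, $\gamma\in[0,1)$, $R\in[0,1]$, and $\rho\in\Delta(\mathcal S)$ with $\rho(s)>0$ for all $s$. Let $\mathcal P^a_s=\{(1-R)p^a_s+Rq: q\in\Delta(\mathcal S)\}$ and $\mathcal P=\bigotimes_{s,a}\mathcal P^a_s$. With the direct parameterization $\Theta=\Delta(\mathcal A)^{|\mathcal S|}$, $\pi_\theta(a|s)=\theta_{s,a}$, put $$V^{\pi}(s)=\max_{\kappa\in\bigotimes_{t\ge 0}\mathcal P}\mathbb E_\kappa\Big[\sum_{t\ge 0}\gamma^t c(S_t,A_t)\,\Big|\,S_0=s,\pi\Big],\qquad J(\theta)=\sum_s\rho(s)V^{\pi_\theta}(s),\qquad J^*=\min_{\theta\in\Theta}J(\theta).$$ For $\sigma>0$ let $\mathrm{LSE}(\sigma,V)=\sigma^{-1}\log\sum_s e^{\sigma V(s)}$. Let $V^\pi_\sigma$ be the unique fixed point of $V\mapsto \big(s\mapsto\sum_a\pi(a|s)\,Q_V(s,a)\big)$,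 where $Q_V(s,a)=c(s,a)+\gamma(1-R)\sum_{s'}p^a_{s}(s')V(s')+\gamma R\,\mathrm{LSE}(\sigma,V)$, and let $Q^\pi_\sigma=Q_{V^\pi_\sigma}$. Write $\delta=1-\gamma+\gamma R$ and $$C_\sigma=\tfrac{1}{1-\gamma}\Big(1+2\gamma R\tfrac{\log|\mathcal S|}{\sigma}\Big),\quad C^V_\sigma=\tfrac{|\mathcal A|C_\sigma}{1-\gamma},\quad k_B=\tfrac{|\mathcal A|C^V_\sigma}{\delta}+\tfrac{2|\mathcal A|^2\gamma(1-R)C_\sigma}{\delta^2},$$ $$L_\sigma=k_B+\tfrac{\gamma R}{1-\gamma}\Big(\sqrt{|\mathcal S|}\,k_B+\tfrac{2\sigma|\mathcal S|\,|\mathcal A|\,C^V_\sigma C_\sigma}{\delta}\Big).$$ **Algorithm (smoothed robust actor-critic, tabular)**, with inputs $\sigma$, step size $\alpha$, batch size $M$, number of iterations $T$ and initial $\theta_0\in\Theta$. In iteration $t=0,\dots,T-1$: 1. *Critic.* Smoothed robust TD is run for the policy $\pi_{\theta_t}$: along a trajectory with $a_k\sim\pi_{\theta_t}(\cdot|s_k)$,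 $s_{k+1}\sim p^{a_k}_{s_k}$, the entry $Q(s_k,a_k)$ is increased by $\beta_k\big(c(s_k,a_k)+\gamma(1-R)V(s_{k+1})+\gamma R\,\mathrm{LSE}(\sigma,V)-Q(s_k,a_k)\big)$, where $V(s)=\sum_a\pi_{\theta_t}(a|s)Q(s,a)$. The initialization (possibly random), the step sizes $\beta_k$ and the almost surely finite, possibly random, number $T_c$ of steps (given by a rule that decides from the step number, the current table and the current state whether to stop) are arbitrary and may depend on the past iterations, but are such that the output $Q_t$ satisfies $\|Q_t-Q^{\pi_{\theta_t}}_\sigma\|_\infty\le\epsilon_{\rm est}$ almost surely. Put $V_t(s)=\sum_a\pi_{\theta_t}(a|s)Q_t(s,a)$. 2. *Actor.* For $i=1,\dots,M$ independently: draw $T^i$ with $\mathbb P(T^i=k)=\delta(1-\delta)^k$, $k\ge 0$; draw $s^i_0\sim\rho$ and $x^i_0$ with probability proportional to $e^{\sigma V_t(\cdot)}$; follow $\pi_{\theta_t}$ under $\mathsf P$ for $T^i$ steps from each; put $g^i_t=B^i_t+\frac{\gamma R}{1-\gamma}D^i_t$ with $B^i_t=\frac1\delta\sum_a\nabla\pi_{\theta_t}(a|s^i_{T^i})Q_t(s^i_{T^i},a)$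 and $D^i_t=\frac1\delta\sum_a\nabla\pi_{\theta_t}(a|x^i_{T^i})Q_t(x^i_{T^i},a)$. 3. $\theta_{t+1}$ is the Euclidean projection onto $\Theta$ of $\theta_t-\alpha\,\frac1M\sum_{i=1}^M g^i_t$. **Theorem.** Let $K>0$ with $K\ge\frac{2\gamma R\log|\mathcal S|}{1-\gamma}$. There are constants $c_{\rm est},c_M,c_T>0$, depending only on $(\mathcal S,\mathcal A,\mathsf P,c,\gamma,R,\rho)$ and $K$, such that for every $\epsilon>0$ the following holds. Set $\sigma=K/\epsilon$ and $\alpha=\frac{1}{2L_\sigma}$, and let $\epsilon_{\rm est}\le c_{\rm est}\,\epsilon^{2}$, $M\ge c_M\,\epsilon^{-2}$ and $T\ge c_T\,\epsilon^{-3}$ (in particular $\epsilon_{\rm est}=c_{\rm est}\epsilon^2$, $M=\lceil c_M\epsilon^{-2}\rceil$ and $T=\lceil c_T\epsilon^{-3}\rceil$ are allowed). Then, for every $\theta_0\in\Theta$, the iterates of the algorithm satisfy $$\min_{0\le t\le T}\mathbb E\big[J(\theta_t)-J^*\big]\le 7\epsilon .$$ -/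

import Mathlib

open scoped BigOperators ENNReal

noncomputable section

namespace RobustAC

/-! ### Direct policy parameterization -/

/-- `Θ = Δ(A)^S`, as a subset of the Euclidean space `ℝ^{S × A}`. -/
def policySet (S A : Type*) [Fintype A] : Set (EuclideanSpace ℝ (S × A)) :=
  {θ | ∀ s, (fun a => θ (s, a)) ∈ stdSimplex ℝ A}

/-- Parameters `θ ∈ Θ`. The policy is `π_θ(a|s) = θ (s, a)`. -/
abbrev Policy (S A : Type*) [Fintype A] : Type _ := ↥(policySet S A)

/-- Tables `Q(s, a)`. -/
abbrev QTable (S A : Type*) := S → A → ℝ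

theorem policySet_nonempty {S A : Type*} [Fintype A] [Nonempty A] : (policySet S A).Nonempty := by
  classical
  obtain ⟨a₀⟩ := ‹Nonempty A›
  refine ⟨WithLp.toLp 2 (fun x => if x.2 = a₀ then 1 else 0), fun s => ⟨fun a => ?_, ?_⟩⟩
  · dsimp; split_ifs <;> norm_num
  · simp

theorem convex_policySet {S A : Type*} [Fintype A] : Convex ℝ (policySet S A) := by
  intro x hx y hy a b ha hb hab s
  exact convex_stdSimplex ℝ A (hx s) (hy s) ha hb hab

theorem isClosed_policySet {S A : Type*} [Fintype A] : IsClosed (policySet S A) := by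
  have : policySet S A = ⋂ s, (fun θ : EuclideanSpace ℝ (S × A) => fun a => θ (s, a)) ⁻¹'
      stdSimplex ℝ A := by
    ext θ; simp [policySet]
  rw [this]
  exact isClosed_iInter fun s => (isClosed_stdSimplex ℝ A).preimage (by fun_prop)

section General

variable {S A : Type*} [Fintype S] [Fintype A]

/-- `π_θ(· | s)` as a probability distribution on actions. -/
def Policy.act (θ : Policy S A) (s : S) : PMF A :=
  PMF.ofFintype (fun a => ENNReal.ofReal (θ.1 (s, a))) (by
    rw [← ENNReal.ofReal_sum_of_nonneg (fun a _ => (θ.2 s).1 a), (θ.2 s).2, ENNReal.ofReal_one])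

/-- `V(s) = ∑ₐ π_θ(a|s) Q(s, a)`. -/
def Policy.avg (θ : Policy S A) (Q : QTable S A) (s : S) : ℝ := ∑ a, θ.1 (s, a) * Q s a

/-- The log-sum-exp operator with parameter `σ > 0`. -/
def lse (σ : ℝ) (V : S → ℝ) : ℝ := Real.log (∑ s, Real.exp (σ * V s)) / σ

theorem lse_le_add_dist [Nonempty S] {σ : ℝ} (hσ : 0 < σ) (V W : S → ℝ) :
    lse σ V ≤ lse σ W + dist V W := by
  have hpos : ∀ V : S → ℝ, 0 < ∑ s, Real.exp (σ * V s) := fun V =>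
    Finset.sum_pos (fun _ _ => Real.exp_pos _) Finset.univ_nonempty
  have h : ∑ s, Real.exp (σ * V s) ≤ Real.exp (σ * dist V W) * ∑ s, Real.exp (σ * W s) := by
    rw [Finset.mul_sum]
    refine Finset.sum_le_sum fun s _ => ?_
    rw [← Real.exp_add]
    refine Real.exp_le_exp.2 ?_
    rw [← mul_add]
    refine mul_le_mul_of_nonneg_left ?_ hσ.le
    have := (le_abs_self _).trans ((Real.dist_eq _ _).ge.trans (dist_le_pi_dist V W s))
    linarith
  have h' := Real.log_le_log (hpos V) h
  rw [Real.log_mul (Real.exp_pos _).ne' (hpos W).ne', Real.log_exp] at h'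
  unfold lse
  rw [div_add' _ _ _ hσ.ne', div_le_div_iff_of_pos_right hσ]
  linarith

/-- The distribution on `S` proportional to `exp (σ V(s))`. -/
def softmax [Nonempty S] (σ : ℝ) (V : S → ℝ) : PMF S :=
  PMF.ofFintype
    (fun s => ENNReal.ofReal (Real.exp (σ * V s) / ∑ s', Real.exp (σ * V s'))) (by
    have h : 0 < ∑ s', Real.exp (σ * V s') :=
      Finset.sum_pos (fun _ _ => Real.exp_pos _) Finset.univ_nonempty
    rw [← ENNReal.ofReal_sum_of_nonneg
      (fun s _ => div_nonneg (Real.exp_pos _).le h.le), ← Finset.sum_div, div_self h.ne',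
      ENNReal.ofReal_one])

theorem exists_projection [Nonempty A] (x : EuclideanSpace ℝ (S × A)) :
    ∃ θ : Policy S A, ∀ θ' : Policy S A, ‖x - θ.1‖ ≤ ‖x - θ'.1‖ := by
  obtain ⟨v, hv, h⟩ := isClosed_policySet.exists_infDist_eq_dist
    (policySet_nonempty (S := S) (A := A)) x
  refine ⟨⟨v, hv⟩, fun θ' => ?_⟩
  have := Metric.infDist_le_dist_of_mem (x := x) θ'.2
  rwa [h, dist_eq_norm, dist_eq_norm] at this

/-- Euclidean projection onto `Θ` (the minimizer is unique because `Θ` is convex). -/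
def proj [Nonempty A] (x : EuclideanSpace ℝ (S × A)) : Policy S A :=
  (exists_projection x).choose

/-- Expectation of a real function under a discrete distribution. -/
def expect {α : Type*} (μ : PMF α) (f : α → ℝ) : ℝ := ∑' x, (μ x).toReal * f x

/-- The geometric distribution `P(T = k) = p (1 - p)^k` on `{0, 1, 2, …}`. -/
def geometricPMF (p : ℝ) (hp0 : 0 < p) (hp1 : p ≤ 1) : PMF ℕ :=
  ⟨fun k => ENNReal.ofReal (p * (1 - p) ^ k), by
    have h := (hasSum_geometric_of_lt_one (r := 1 - p) (by linarith) (by linarith)).mul_left p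
    rw [sub_sub_cancel, mul_inv_cancel₀ hp0.ne'] at h
    have hn : ∀ k, 0 ≤ p * (1 - p) ^ k := fun k =>
      mul_nonneg hp0.le (pow_nonneg (by linarith) k)
    have h' := ENNReal.ofReal_tsum_of_nonneg hn h.summable
    rw [h.tsum_eq, ENNReal.ofReal_one] at h'
    rw [h']
    exact ENNReal.summable.hasSum⟩

/-- `n` independent draws from `μ`. -/
def iidList {α : Type*} (μ : PMF α) : ℕ → PMF (List α)
  | 0 => PMF.pure []
  | n + 1 => μ.bind fun x => (iidList μ n).map (x :: ·)

/-- The gradient `∇_θ π_θ(a|s)` of the direct parameterization. -/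
def gradPolicy [DecidableEq S] [DecidableEq A] (s : S) (a : A) : EuclideanSpace ℝ (S × A) :=
  EuclideanSpace.single (s, a) 1

theorem hasGradientAt_policy [DecidableEq S] [DecidableEq A] (s : S) (a : A)
    (θ : EuclideanSpace ℝ (S × A)) :
    HasGradientAt (fun η : EuclideanSpace ℝ (S × A) => η (s, a)) (gradPolicy s a) θ := by
  rw [hasGradientAt_iff_hasFDerivAt]
  have h : (InnerProductSpace.toDual ℝ (EuclideanSpace ℝ (S × A))) (gradPolicy s a) =
      EuclideanSpace.proj (s, a) := by
    ext η
    simp [gradPolicy, EuclideanSpace.inner_single_left]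
  rw [h]
  exact (EuclideanSpace.proj (𝕜 := ℝ) (s, a)).hasFDerivAt

end General

/-! ### Robust Markov decision processes with `R`-contamination -/

/-- A finite discounted cost MDP with nominal kernel `P`, contamination level `R` and an initial
distribution `ρ` charging every state. -/
structure RobustMDP (S A : Type*) where
  P : S → A → PMF S
  c : S → A → ℝ
  γ : ℝ
  R : ℝ
  ρ : PMF S
  c_nonneg : ∀ s a, 0 ≤ c s a
  c_le_one : ∀ s a, c s a ≤ 1
  γ_nonneg : 0 ≤ γ
  γ_lt_one : γ < 1
  R_nonneg : 0 ≤ R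
  R_le_one : R ≤ 1
  ρ_pos : ∀ s, 0 < ρ s

namespace RobustMDP

/-- Nominal transition probability `p^a_{s,s'}`. -/
def p {S A : Type*} (m : RobustMDP S A) (s : S) (a : A) (s' : S) : ℝ := (m.P s a s').toReal

theorem sum_p {S A : Type*} [Fintype S] (m : RobustMDP S A) (s : S) (a : A) : ∑ s', m.p s a s' = 1 := by
  have h := (m.P s a).tsum_coe
  rw [tsum_fintype] at h
  unfold p
  rw [← ENNReal.toReal_sum (fun s' _ => (m.P s a).apply_ne_top s'), h, ENNReal.toReal_one]

/-- `1 - γ + γR`. -/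
def δ {S A : Type*} (m : RobustMDP S A) : ℝ := 1 - m.γ + m.γ * m.R

theorem δ_pos {S A : Type*} (m : RobustMDP S A) : 0 < m.δ := by
  have := m.γ_lt_one
  have := mul_nonneg m.γ_nonneg m.R_nonneg
  unfold δ; linarith

theorem δ_le_one {S A : Type*} (m : RobustMDP S A) : m.δ ≤ 1 := by
  have := mul_le_of_le_one_right m.γ_nonneg m.R_le_one
  unfold δ; linarith

variable {S A : Type*} [Fintype S] [DecidableEq S] [Fintype A] [DecidableEq A]
variable (m : RobustMDP S A)

/-- The uncertainty set `{(1 - R) p^a_s + R q | q ∈ Δ(S)}`. -/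
def uncertainty (s : S) (a : A) : Set (S → ℝ) :=
  {x | ∃ q ∈ stdSimplex ℝ S, x = fun s' => (1 - m.R) * m.p s a s' + m.R * q s'}

/-- Nature's policies: sequences of kernels chosen from the rectangular uncertainty set. -/
def Nature : Type _ := {κ : ℕ → S → A → S → ℝ // ∀ t s a, κ t s a ∈ m.uncertainty s a}

/-- `P(S_t = · | S_0 = s₀)` under policy `π_θ` and the time-varying kernels `κ`. -/
def stateDist (κ : ℕ → S → A → S → ℝ) (θ : Policy S A) (s₀ : S) : ℕ → S → ℝ
  | 0 => Pi.single s₀ 1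
  | t + 1 => fun s' => ∑ s, ∑ a, stateDist κ θ s₀ t s * θ.1 (s, a) * κ t s a s'

/-- The expected discounted cost `E_κ[∑_t γ^t c(S_t, A_t) | S_0 = s₀, π_θ]`. -/
def discountedCost (κ : ℕ → S → A → S → ℝ) (θ : Policy S A) (s₀ : S) : ℝ :=
  ∑' t : ℕ, m.γ ^ t * ∑ s, ∑ a, stateDist κ θ s₀ t s * θ.1 (s, a) * m.c s a

/-- The robust value function `V^{π_θ}(s)`: worst case over nature's policies. -/
def robustValue (θ : Policy S A) (s : S) : ℝ := ⨆ κ : m.Nature, m.discountedCost κ.1 θ s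

/-- `J(θ) = E_{S ∼ ρ}[V^{π_θ}(S)]`. -/
def J (θ : Policy S A) : ℝ := ∑ s, (m.ρ s).toReal * m.robustValue θ s

/-- The optimal value `J^* = min_{θ ∈ Θ} J(θ)`. -/
def Jstar : ℝ := ⨅ θ : Policy S A, m.J θ

/-! ### Smoothed robust value functions -/

/-- One-step look-ahead with the support function of the uncertainty set smoothed by
log-sum-exp. -/
def lookahead (σ : ℝ) (V : S → ℝ) : QTable S A := fun s a =>
  m.c s a + m.γ * (1 - m.R) * ∑ s', m.p s a s' * V s' + m.γ * m.R * lse σ V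

/-- The smoothed robust Bellman operator `T_σ^π`. -/
def smoothedBellman (σ : ℝ) (θ : Policy S A) (V : S → ℝ) : S → ℝ :=
  θ.avg (m.lookahead σ V)

/-- The smoothed robust value function: the fixed point of the smoothed Bellman operator (for
`σ > 0` it exists and is unique, see `existsUnique_smoothedValue`). -/
def smoothedValue (σ : ℝ) (θ : Policy S A) : S → ℝ :=
  Classical.epsilon fun V => m.smoothedBellman σ θ V = V

/-- The smoothed robust action-value function `Q_σ^{π_θ}`. -/
def smoothedQ (σ : ℝ) (θ : Policy S A) : QTable S A := m.lookahead σ (m.smoothedValue σ θ)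

theorem existsUnique_smoothedValue [Nonempty S] {σ : ℝ} (hσ : 0 < σ) (θ : Policy S A) :
    ∃! V, m.smoothedBellman σ θ V = V := by
  have hlip : LipschitzWith m.γ.toNNReal (m.smoothedBellman σ θ) := by
    refine LipschitzWith.of_dist_le_mul fun V W => ?_
    rw [Real.coe_toNNReal _ m.γ_nonneg]
    refine (dist_pi_le_iff (mul_nonneg m.γ_nonneg dist_nonneg)).2 fun s => ?_
    have hQ : ∀ V W : S → ℝ, ∀ a, m.lookahead σ V s a ≤
        m.lookahead σ W s a + m.γ * dist V W := by
      intro V W a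
      have h1 : ∑ s', m.p s a s' * V s' ≤ ∑ s', m.p s a s' * W s' + dist V W := by
        calc ∑ s', m.p s a s' * V s' ≤ ∑ s', m.p s a s' * (W s' + dist V W) := by
              refine Finset.sum_le_sum fun s' _ =>
                mul_le_mul_of_nonneg_left ?_ ENNReal.toReal_nonneg
              have := (le_abs_self _).trans ((Real.dist_eq _ _).ge.trans (dist_le_pi_dist V W s'))
              linarith
          _ = _ := by
              simp only [mul_add, Finset.sum_add_distrib, ← Finset.sum_mul, m.sum_p, one_mul]
      have h2 := lse_le_add_dist hσ V W
      have h3 := mul_le_mul_of_nonneg_left h1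
        (mul_nonneg m.γ_nonneg (sub_nonneg.2 m.R_le_one))
      have h4 := mul_le_mul_of_nonneg_left h2 (mul_nonneg m.γ_nonneg m.R_nonneg)
      unfold lookahead
      linarith
    have hV : ∀ V W : S → ℝ, m.smoothedBellman σ θ V s ≤
        m.smoothedBellman σ θ W s + m.γ * dist V W := by
      intro V W
      unfold smoothedBellman Policy.avg
      calc _ ≤ ∑ a, θ.1 (s, a) * (m.lookahead σ W s a + m.γ * dist V W) :=
            Finset.sum_le_sum fun a _ => mul_le_mul_of_nonneg_left (hQ V W a) ((θ.2 s).1 a)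
        _ = _ := by
            have := (θ.2 s).2
            simp only [mul_add, Finset.sum_add_distrib, ← Finset.sum_mul]
            rw [this, one_mul]
    have a1 := hV V W
    have a2 := hV W V
    rw [dist_comm W V] at a2
    rw [Real.dist_eq, abs_le]
    constructor <;> linarith
  have hc : ContractingWith m.γ.toNNReal (m.smoothedBellman σ θ) :=
    ⟨by simpa using m.γ_lt_one, hlip⟩
  exact ⟨_, hc.fixedPoint_isFixedPt, fun V hV => hc.fixedPoint_unique hV⟩

/-! ### Constants -/

/-- `C_σ`, an upper bound on the smoothed robust action-value functions. -/
def Cσ (σ : ℝ) : ℝ :=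
  1 / (1 - m.γ) * (1 + 2 * m.γ * m.R * (Real.log (Fintype.card S) / σ))

/-- `C^V_σ`, a Lipschitz constant of `θ ↦ V_σ^{π_θ}(s)`. -/
def CVσ (σ : ℝ) : ℝ := 1 / (1 - m.γ) * Fintype.card A * m.Cσ σ

/-- `k_B`; here `π_θ` is `1`-Lipschitz and `0`-smooth in `θ`. -/
def kB (σ : ℝ) : ℝ :=
  1 / m.δ * (Fintype.card A * m.CVσ σ) +
    2 * (Fintype.card A : ℝ) ^ 2 * m.γ * (1 - m.R) / m.δ ^ 2 * m.Cσ σ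

/-- The smoothness constant `L_σ` of the smoothed objective. -/
def Lσ (σ : ℝ) : ℝ :=
  m.kB σ + m.γ * m.R / (1 - m.γ) *
    (Real.sqrt (Fintype.card S) * m.kB σ +
      2 * σ * Fintype.card S * m.CVσ σ * (1 / m.δ) * Fintype.card A * m.Cσ σ)

/-! ### The critic: smoothed robust TD, tabular -/

/-- One step of smoothed robust TD with step size `β` from table `Q` and current state `s`: draw
`a ∼ π_θ(·|s)`, `s' ∼ p^a_s`, and update the entry `(s, a)`. -/
def tdStep (σ : ℝ) (θ : Policy S A) (β : ℝ) (z : QTable S A × S) : PMF (QTable S A × S) :=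
  (θ.act z.2).bind fun a => (m.P z.2 a).map fun s' =>
    (Function.update z.1 z.2 (Function.update (z.1 z.2) a
      (z.1 z.2 a + β * (m.c z.2 a + m.γ * (1 - m.R) * θ.avg z.1 s'
        + m.γ * m.R * lse σ (θ.avg z.1) - z.1 z.2 a))), s')

open Classical in
/-- Run TD from step number `k` on for at most `n` more steps; the run ends with output `some z`
at the first step number `k'` with `halt k' z`, and is `none` if it has not ended by then. -/
def tdRun (σ : ℝ) (θ : Policy S A) (β : ℕ → ℝ) (halt : ℕ → QTable S A × S → Prop) :
    ℕ → ℕ → QTable S A × S → PMF (Option (QTable S A × S))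
  | 0, k, z => if halt k z then PMF.pure (some z) else PMF.pure none
  | n + 1, k, z => if halt k z then PMF.pure (some z) else
      (m.tdStep σ θ (β k) z).bind (tdRun σ θ β halt n (k + 1))

/-- `ν` is the law of the output (table and last state) of smoothed robust TD for the policy
`π_θ`, for some (possibly random) initialization, step sizes and halting rule under which the run
ends almost surely. The halting rule may be `k = T_c` for a fixed number of steps, or "the table
is accurate enough". -/
def IsTDOutput (σ : ℝ) (θ : Policy S A) (ν : PMF (QTable S A × S)) : Prop :=
  ∃ (init : PMF (QTable S A × S)) (β : ℕ → ℝ) (halt : ℕ → QTable S A × S → Prop),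
    ∀ z, ν z = ⨆ n : ℕ, (init.bind (m.tdRun σ θ β halt n 0)) (some z)

/-! ### The actor -/

/-- The state at time `n` of the chain with kernel `P` started at `s`, following `π_θ`. -/
def walk (θ : Policy S A) : ℕ → S → PMF S
  | 0, s => PMF.pure s
  | n + 1, s => (θ.act s).bind fun a => (m.P s a).bind (walk θ n)

/-- The pair `(s_T, x_T)` of one inner iteration: `T ∼ Geom(1 - γ + γR)`, and two trajectories
of length `T`, from `s_0 ∼ ρ` and from `x_0 ∼ softmax(σ, V)`, `V(s) = ∑ₐ π_θ(a|s) Q(s, a)`. -/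
def samplePair [Nonempty S] (σ : ℝ) (θ : Policy S A) (Q : QTable S A) : PMF (S × S) :=
  (geometricPMF m.δ m.δ_pos m.δ_le_one).bind fun T =>
    m.ρ.bind fun s₀ => (m.walk θ T s₀).bind fun sT =>
      (softmax σ (θ.avg Q)).bind fun x₀ => (m.walk θ T x₀).map fun xT => (sT, xT)

/-- `(1 - γ + γR)⁻¹ ∑ₐ Q(s, a) ∇π_θ(a|s)`. -/
def gradTerm (Q : QTable S A) (s : S) : EuclideanSpace ℝ (S × A) :=
  (1 / m.δ) • ∑ a, Q s a • gradPolicy s a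

/-- The gradient estimate `B + γR/(1 - γ) D` from one pair. -/
def gradSample (Q : QTable S A) (z : S × S) : EuclideanSpace ℝ (S × A) :=
  m.gradTerm Q z.1 + (m.γ * m.R / (1 - m.γ)) • m.gradTerm Q z.2

/-- The average of the gradient estimates over a batch. -/
def gradBatch (Q : QTable S A) (zs : List (S × S)) : EuclideanSpace ℝ (S × A) :=
  (1 / (zs.length : ℝ)) • (zs.map (m.gradSample Q)).sum

/-- The current parameter, and the list of all earlier iterations (latest first), each with its
parameter, the output of its critic (table and last TD state) and its batch. -/
abbrev History (S A : Type*) [Fintype A] :=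
  Policy S A × List (Policy S A × (QTable S A × S) × List (S × S))

/-- The law of the history after `t` iterations of the smoothed robust actor-critic with
smoothing `σ`, step size `α`, batch size `M`, initial parameter `θ₀`, where `critic h` is the law
of the critic's output after the history `h`. -/
def law [Nonempty S] [Nonempty A] (σ α : ℝ) (M : ℕ) (θ₀ : Policy S A)
    (critic : History S A → PMF (QTable S A × S)) : ℕ → PMF (History S A)
  | 0 => PMF.pure (θ₀, [])
  | t + 1 => (law σ α M θ₀ critic t).bind fun h => (critic h).bind fun q =>
      (iidList (m.samplePair σ h.1 q.1) M).map fun zs =>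
        (proj (h.1.1 - α • m.gradBatch q.1 zs), (h.1, q, zs) :: h.2)

end RobustMDP

end RobustAC

end

set_option linter.unusedSectionVars false

/-! The smoothed objective J_σ satisfies J ≤ J_σ ≤ J + γR/(1-γ) · log|S|/σ, so with σ = K/ε the
optimality gap of J is that of J_σ up to ε/2. Two inequalities for J_σ carry the proof, and both
come from one device, `sum_mul_le_of_le`: a one-step inequality u ≤ f + γ(1-R) P_θ u + γR ⟨η, u⟩,
integrated against the discounted visitation measure of the nominal chain redrawn from η with
probability R, yields ⟨ρ, u⟩ ≤ ⟨visitation, f⟩. Here u is a difference of two smoothed value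
functions and η is a softmax. Bounding the log-sum-exp increment above by Hoeffding's lemma gives
L_σ-smoothness (`smoothedJ_le_add`); bounding it by convexity gives gradient domination
(`smoothedJ_sub_le`). No derivative of J_σ is ever taken: `smoothedGrad` serves only as the slope in
these two inequalities and as the target of the estimator.

For a projected step d of size parameter 1/(2L_σ) with gradient error e, smoothness bounds L_σ‖d‖²
by the decrease of J_σ plus ‖e‖²/(2L_σ), while domination bounds the gap at the current iterate by a
linear expression in L_σ‖d‖ and ‖e‖. Young's inequality at scale ε joins the two
(`J_sub_Jstar_le_of_step`). In expectation ‖e‖² is a variance O(1/M) plus a squared bias; the bias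
is O((1+σ) ε_est), because the critic enters the softmax through σV, so ε_est of order ε² makes it
O(ε). Averaging over the iterations telescopes J_σ with weight w of order L_σ/ε = O(ε⁻²), and w/T ≤
O(ε) requires T of order ε⁻³. -/

namespace RobustAC

/-! ### Expectations under discrete laws. -/

section Expect

variable {α β : Type*}

/-- `f` is bounded on the support of `μ`. -/
def BddOn (μ : PMF α) (f : α → ℝ) : Prop := ∃ C, ∀ x ∈ μ.support, |f x| ≤ C

theorem summable_toReal_pmf (μ : PMF α) : Summable fun x => (μ x).toReal :=
  ENNReal.summable_toReal μ.tsum_coe_ne_top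

theorem tsum_toReal_pmf (μ : PMF α) : ∑' x, (μ x).toReal = 1 := by
  have h : (∑' x, μ x).toReal = _ := ENNReal.tsum_toReal_eq μ.apply_ne_top
  rw [← h, μ.tsum_coe, ENNReal.toReal_one]

theorem sum_toReal_pmf [Fintype α] (μ : PMF α) : ∑ x, (μ x).toReal = 1 := by
  exact (tsum_fintype _).symm.trans (tsum_toReal_pmf μ)

theorem toReal_eq_zero_of_notMem_support {μ : PMF α} {x : α} (hx : x ∉ μ.support) :
    (μ x).toReal = 0 := by
  rw [(μ.apply_eq_zero_iff x).2 hx, ENNReal.toReal_zero]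

theorem BddOn.summable {μ : PMF α} {f : α → ℝ} (h : BddOn μ f) :
    Summable fun x => (μ x).toReal * f x := by
  obtain ⟨C, hC⟩ := h
  refine Summable.of_norm_bounded ((summable_toReal_pmf μ).mul_right C) fun x => ?_
  by_cases hx : x ∈ μ.support
  · rw [norm_mul, Real.norm_of_nonneg ENNReal.toReal_nonneg]
    exact mul_le_mul_of_nonneg_left (hC x hx) ENNReal.toReal_nonneg
  · simp [toReal_eq_zero_of_notMem_support hx]

theorem BddOn.add {μ : PMF α} {f g : α → ℝ} (hf : BddOn μ f) (hg : BddOn μ g) :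
    BddOn μ fun x => f x + g x := by
  obtain ⟨C, hC⟩ := hf
  obtain ⟨D, hD⟩ := hg
  exact ⟨C + D, fun x hx => (abs_add_le _ _).trans (add_le_add (hC x hx) (hD x hx))⟩

theorem BddOn.const_mul {μ : PMF α} {f : α → ℝ} (hf : BddOn μ f) (c : ℝ) :
    BddOn μ fun x => c * f x := by
  obtain ⟨C, hC⟩ := hf
  exact ⟨|c| * C, fun x hx => by
    rw [abs_mul]; exact mul_le_mul_of_nonneg_left (hC x hx) (abs_nonneg c)⟩

theorem bddOn_const (μ : PMF α) (c : ℝ) : BddOn μ fun _ => c := ⟨|c|, fun _ _ => le_rfl⟩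

theorem BddOn.of_finite {μ : PMF α} (h : μ.support.Finite) (f : α → ℝ) : BddOn μ f := by
  obtain ⟨C, hC⟩ := (h.image fun x => |f x|).bddAbove
  exact ⟨C, fun x hx => hC ⟨x, hx, rfl⟩⟩

theorem expect_mono {μ : PMF α} {f g : α → ℝ} (hf : BddOn μ f) (hg : BddOn μ g)
    (h : ∀ x ∈ μ.support, f x ≤ g x) : expect μ f ≤ expect μ g := by
  refine hf.summable.tsum_le_tsum (fun x => ?_) hg.summable
  by_cases hx : x ∈ μ.support
  · exact mul_le_mul_of_nonneg_left (h x hx) ENNReal.toReal_nonneg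
  · simp [toReal_eq_zero_of_notMem_support hx]

theorem expect_add {μ : PMF α} {f g : α → ℝ} (hf : BddOn μ f) (hg : BddOn μ g) :
    expect μ (fun x => f x + g x) = expect μ f + expect μ g := by
  unfold expect
  simp only [mul_add]
  exact hf.summable.tsum_add hg.summable

theorem expect_const_mul (μ : PMF α) (c : ℝ) (f : α → ℝ) :
    expect μ (fun x => c * f x) = c * expect μ f := by
  unfold expect
  rw [← tsum_mul_left]
  exact tsum_congr fun x => by ring

theorem expect_const (μ : PMF α) (c : ℝ) : expect μ (fun _ => c) = c := by
  unfold expect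
  rw [tsum_mul_right, tsum_toReal_pmf, one_mul]

theorem expect_fintype [Fintype α] (μ : PMF α) (f : α → ℝ) :
    expect μ f = ∑ x, (μ x).toReal * f x := tsum_fintype _

theorem abs_expect_le {μ : PMF α} {f : α → ℝ} {C : ℝ} (h : ∀ x ∈ μ.support, |f x| ≤ C) :
    |expect μ f| ≤ C := by
  have hf : BddOn μ f := ⟨C, h⟩
  have h1 := expect_mono hf (bddOn_const μ C) fun x hx => (abs_le.1 (h x hx)).2
  have h2 := expect_mono (bddOn_const μ (-C)) hf fun x hx => (abs_le.1 (h x hx)).1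
  rw [expect_const] at h1 h2
  exact abs_le.2 ⟨h2, h1⟩

theorem expect_pure (a : α) (f : α → ℝ) : expect (PMF.pure a) f = f a := by
  unfold expect
  rw [tsum_eq_single a]
  · simp
  · intro b hb
    simp [PMF.pure_apply, hb]

/-- Fubini for sums. The bound on the support dominates the double series by a multiple of the joint
mass; without summability `tsum` would take its default value 0. -/
theorem expect_bind {μ : PMF α} {k : α → PMF β} {f : β → ℝ} (h : BddOn (μ.bind k) f) :
    expect (μ.bind k) f = expect μ fun x => expect (k x) f := by
  obtain ⟨C, hC⟩ := h
  have hsum : Summable fun z : α × β => (μ z.1).toReal * (k z.1 z.2).toReal := by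
    have : ∑' z : α × β, μ z.1 * k z.1 z.2 ≠ ∞ := by
      rw [ENNReal.tsum_prod (f := fun x y => μ x * k x y)]
      simp [ENNReal.tsum_mul_left, PMF.tsum_coe]
    simpa using ENNReal.summable_toReal this
  have hF : Summable (Function.uncurry fun (x : α) (y : β) =>
      (μ x).toReal * ((k x y).toReal * f y)) := by
    refine Summable.of_norm_bounded (hsum.mul_right C) ?_
    rintro ⟨x, y⟩
    simp only [Function.uncurry]
    rw [← mul_assoc, norm_mul,
      Real.norm_of_nonneg (mul_nonneg ENNReal.toReal_nonneg ENNReal.toReal_nonneg)]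
    by_cases hxy : y ∈ (μ.bind k).support
    · exact mul_le_mul_of_nonneg_left (hC y hxy)
        (mul_nonneg ENNReal.toReal_nonneg ENNReal.toReal_nonneg)
    -- Outside the support of the mixture each product of masses vanishes, so values of `f` there do
    -- not matter.
    · have h0 : μ x * k x y = 0 := by
        have := (PMF.apply_eq_zero_iff _ _).2 hxy
        rw [PMF.bind_apply, ENNReal.tsum_eq_zero] at this
        exact this x
      rw [← ENNReal.toReal_mul, h0]
      simp
  unfold expect
  calc ∑' y, ((μ.bind k) y).toReal * f y
      = ∑' y, ∑' x, (μ x).toReal * ((k x y).toReal * f y) := by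
        refine tsum_congr fun y => ?_
        rw [PMF.bind_apply, ENNReal.tsum_toReal_eq, ← tsum_mul_right]
        · exact tsum_congr fun x => by rw [ENNReal.toReal_mul, mul_assoc]
        · exact fun x => ENNReal.mul_ne_top (μ.apply_ne_top x) ((k x).apply_ne_top y)
    _ = ∑' x, ∑' y, (μ x).toReal * ((k x y).toReal * f y) := hF.tsum_comm
    _ = _ := tsum_congr fun x => tsum_mul_left

theorem expect_map {μ : PMF α} {g : α → β} {f : β → ℝ} (h : BddOn (μ.map g) f) :
    expect (μ.map g) f = expect μ fun x => f (g x) := by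
  have h' : BddOn (μ.bind (PMF.pure ∘ g)) f := h
  refine (expect_bind h').trans ?_
  simp [expect_pure]

theorem BddOn.expect_bind {μ : PMF α} {k : α → PMF β} {f : β → ℝ} (h : BddOn (μ.bind k) f) :
    BddOn μ fun x => expect (k x) f := by
  obtain ⟨C, hC⟩ := h
  exact ⟨C, fun x hx => abs_expect_le fun y hy =>
    hC y ((PMF.mem_support_bind_iff _ _ _).2 ⟨x, hx, hy⟩)⟩

theorem length_of_mem_support_iidList (μ : PMF α) :
    ∀ (n : ℕ), ∀ zs ∈ (iidList μ n).support, zs.length = n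
  | 0, zs, h => by
    simp only [iidList, PMF.support_pure, Set.mem_singleton_iff] at h
    simp [h]
  | n + 1, zs, h => by
    simp only [iidList, PMF.mem_support_bind_iff, PMF.mem_support_map_iff] at h
    obtain ⟨x, -, ys, hys, rfl⟩ := h
    simp [length_of_mem_support_iidList μ n ys hys]

theorem finite_support_iidList [Finite α] (μ : PMF α) (n : ℕ) : (iidList μ n).support.Finite :=
  (List.finite_length_eq α n).subset fun zs h => length_of_mem_support_iidList μ n zs h

theorem bddOn_iidList [Finite α] (μ : PMF α) (n : ℕ) (f : List α → ℝ) :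
    BddOn (iidList μ n) f := .of_finite (finite_support_iidList μ n) f

theorem bddOn_finite [Finite α] (μ : PMF α) (f : α → ℝ) : BddOn μ f := .of_finite (Set.toFinite _) f

theorem expect_iidList_norm_sq_sum [Fintype α] {E : Type*} [NormedAddCommGroup E]
    [InnerProductSpace ℝ E] (μ : PMF α) (X : α → E) (hX : ∑ z, (μ z).toReal • X z = 0) (n : ℕ) :
    expect (iidList μ n) (fun zs => ‖(zs.map X).sum‖ ^ 2) =
      n * expect μ fun z => ‖X z‖ ^ 2 := by
  induction n with
  | zero => simp [iidList, expect_pure]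
  | succ n ih =>
    -- Independence lets the new sample be drawn last; given the others, its mean is zero and the
    -- cross term disappears.
    have hlaw : iidList μ (n + 1) = (iidList μ n).bind fun zs => μ.map fun z => z :: zs := by
      simp only [iidList, PMF.map, Function.comp_def]
      exact PMF.bind_comm _ _ _
    have hb := bddOn_iidList μ (n + 1) fun zs => ‖(zs.map X).sum‖ ^ 2
    rw [hlaw] at hb ⊢
    rw [expect_bind hb]
    have hin : ∀ zs : List α, expect (μ.map fun z => z :: zs) (fun zs => ‖(zs.map X).sum‖ ^ 2) =
        expect μ (fun z => ‖X z‖ ^ 2) + ‖(zs.map X).sum‖ ^ 2 := by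
      intro zs
      rw [expect_map (.of_finite ((Set.toFinite μ.support).image _ |>.subset
        (by rw [PMF.support_map])) _)]
      simp only [List.map_cons, List.sum_cons, expect_fintype, norm_add_sq_real]
      have : ∑ z, (μ z).toReal * inner ℝ (X z) (zs.map X).sum = 0 := by
        simp only [← real_inner_smul_left]
        rw [← sum_inner, hX, inner_zero_left]
      simp only [mul_add, Finset.sum_add_distrib]
      rw [← Finset.sum_mul, sum_toReal_pmf]
      have h2 : ∑ z, (μ z).toReal * (2 * inner ℝ (X z) (zs.map X).sum) = 0 := by
        simp only [mul_left_comm _ (2 : ℝ)]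
        rw [← Finset.mul_sum, this, mul_zero]
      rw [h2]; ring
    simp only [hin]
    rw [expect_add (bddOn_const _ _) (bddOn_iidList _ _ _), expect_const, ih]
    push_cast; ring

end Expect

/-! ### Log-sum-exp and softmax. -/

section LogSumExp

variable {S : Type*} [Fintype S]

theorem sum_exp_pos [Nonempty S] (f : S → ℝ) : 0 < ∑ s, Real.exp (f s) :=
  Finset.sum_pos (fun _ _ => Real.exp_pos _) Finset.univ_nonempty

theorem softmax_toReal [Nonempty S] (σ : ℝ) (V : S → ℝ) (s : S) :
    (softmax σ V s).toReal = Real.exp (σ * V s) / ∑ s', Real.exp (σ * V s') := by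
  unfold softmax
  rw [PMF.ofFintype_apply, ENNReal.toReal_ofReal]
  exact div_nonneg (Real.exp_pos _).le (sum_exp_pos _).le

theorem exp_mul_lse [Nonempty S] {σ : ℝ} (hσ : 0 < σ) (V : S → ℝ) :
    Real.exp (σ * lse σ V) = ∑ s, Real.exp (σ * V s) := by
  unfold lse
  rw [mul_div_cancel₀ _ hσ.ne', Real.exp_log (sum_exp_pos _)]

/-- Increments of log-sum-exp are cumulants of the increment under the softmax law; both the
convexity bound and Hoeffding's bound rest on this. -/
theorem sum_softmax_mul_exp [Nonempty S] {σ : ℝ} (hσ : 0 < σ) (V u : S → ℝ) :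
    ∑ s, (softmax σ V s).toReal * Real.exp (σ * u s) =
      Real.exp (σ * (lse σ (fun s => V s + u s) - lse σ V)) := by
  rw [mul_sub, Real.exp_sub, exp_mul_lse hσ, exp_mul_lse hσ, Finset.sum_div]
  refine Finset.sum_congr rfl fun s _ => ?_
  rw [softmax_toReal, mul_add, Real.exp_add]
  ring

/-- Jensen's inequality for the exponential, through its tangent line at the mean. Equivalently,
log-sum-exp is convex with the softmax as its gradient. -/
theorem sum_softmax_le_lse_sub [Nonempty S] {σ : ℝ} (hσ : 0 < σ) (V u : S → ℝ) :
    ∑ s, (softmax σ V s).toReal * u s ≤ lse σ (fun s => V s + u s) - lse σ V := by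
  set e := ∑ s, (softmax σ V s).toReal * u s with he
  have h : Real.exp (σ * e) ≤ Real.exp (σ * (lse σ (fun s => V s + u s) - lse σ V)) := by
    rw [← sum_softmax_mul_exp hσ]
    calc Real.exp (σ * e)
        = ∑ s, (softmax σ V s).toReal * (Real.exp (σ * e) * (σ * u s - σ * e + 1)) := by
          have h1 := sum_toReal_pmf (softmax σ V)
          have : ∀ s, (softmax σ V s).toReal * (Real.exp (σ * e) * (σ * u s - σ * e + 1)) =
              (Real.exp (σ * e) * σ) * ((softmax σ V s).toReal * u s) +
              (Real.exp (σ * e) * (1 - σ * e)) * (softmax σ V s).toReal := fun s => by ring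
          simp only [this]
          rw [Finset.sum_add_distrib, ← Finset.mul_sum, ← Finset.mul_sum, h1, ← he]
          ring
      _ ≤ _ := by
          refine Finset.sum_le_sum fun s _ => mul_le_mul_of_nonneg_left ?_ ENNReal.toReal_nonneg
          calc _ ≤ Real.exp (σ * e) * Real.exp (σ * u s - σ * e) :=
                mul_le_mul_of_nonneg_left (Real.add_one_le_exp _) (Real.exp_pos _).le
            _ = _ := by rw [← Real.exp_add]; ring_nf
  exact le_of_mul_le_mul_left (Real.exp_le_exp.1 h) hσ

/-- Hoeffding's lemma for the log-sum-exp operator. -/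
theorem lse_sub_le_sum_softmax_add [Nonempty S] {σ : ℝ} (hσ : 0 < σ) (V u : S → ℝ) {a b : ℝ}
    (hab : a ≤ b) (hu : ∀ s, u s ∈ Set.Icc a b) :
    lse σ (fun s => V s + u s) - lse σ V ≤
      ∑ s, (softmax σ V s).toReal * u s + σ / 8 * (b - a) ^ 2 := by
  let _ : MeasurableSpace S := ⊤
  set e := ∑ s, (softmax σ V s).toReal * u s with he
  have hint : ∀ f : S → ℝ, ∫ s, f s ∂(softmax σ V).toMeasure =
      ∑ s, (softmax σ V s).toReal * f s := fun f => by
    rw [PMF.integral_eq_sum]; rfl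
  have h := (ProbabilityTheory.hasSubgaussianMGF_of_mem_Icc
    (μ := (softmax σ V).toMeasure) (X := u) measurable_from_top.aemeasurable
    (Filter.Eventually.of_forall hu)).mgf_le σ
  rw [ProbabilityTheory.mgf, hint, hint, ← he] at h
  have hl : ∑ s, (softmax σ V s).toReal * Real.exp (σ * (u s - e)) =
      Real.exp (σ * (lse σ (fun s => V s + u s) - lse σ V - e)) := by
    rw [mul_sub, Real.exp_sub, ← sum_softmax_mul_exp hσ, Finset.sum_div]
    refine Finset.sum_congr rfl fun s _ => ?_
    rw [mul_sub, Real.exp_sub, mul_div_assoc]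
  rw [hl, Real.exp_le_exp] at h
  -- A variable in [a, b] has sub-Gaussian parameter ((b-a)/2)²; the exponent is half of this times
  -- σ², and division by σ leaves σ(b-a)²/8.
  have hc : (((‖b - a‖₊ / 2) ^ 2 : NNReal) : ℝ) = (b - a) ^ 2 / 4 := by
    push_cast
    rw [Real.norm_of_nonneg (sub_nonneg.2 hab)]
    ring
  rw [hc] at h
  have : σ * (lse σ (fun s => V s + u s) - lse σ V - e) ≤ σ * (σ / 8 * (b - a) ^ 2) := by
    linarith
  have := le_of_mul_le_mul_left this hσ
  linarith

theorem le_lse [Nonempty S] {σ : ℝ} (hσ : 0 < σ) (V : S → ℝ) (s : S) : V s ≤ lse σ V := by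
  have h : Real.exp (σ * V s) ≤ Real.exp (σ * lse σ V) := by
    rw [exp_mul_lse hσ]
    exact Finset.single_le_sum (f := fun s => Real.exp (σ * V s))
      (fun _ _ => (Real.exp_pos _).le) (Finset.mem_univ s)
  exact le_of_mul_le_mul_left (Real.exp_le_exp.1 h) hσ

theorem lse_le_add_log [Nonempty S] {σ : ℝ} (hσ : 0 < σ) {V : S → ℝ} {b : ℝ} (h : ∀ s, V s ≤ b) :
    lse σ V ≤ b + Real.log (Fintype.card S) / σ := by
  have h1 : ∑ s, Real.exp (σ * V s) ≤ Fintype.card S * Real.exp (σ * b) := by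
    rw [← nsmul_eq_mul, ← Finset.card_univ, ← Finset.sum_const]
    exact Finset.sum_le_sum fun s _ =>
      Real.exp_le_exp.2 (mul_le_mul_of_nonneg_left (h s) hσ.le)
  have h2 := Real.log_le_log (sum_exp_pos _) h1
  rw [Real.log_mul (by simp) (Real.exp_pos _).ne', Real.log_exp] at h2
  unfold lse
  rw [add_div' _ _ _ hσ.ne', div_le_div_iff_of_pos_right hσ]
  linarith

/-- The log of a softmax weight is σ(V s - lse V), and both terms move by at most r, so the
log-ratio is at most 2σr; then |eˣ - 1| ≤ 2|x| for |x| ≤ 1. The error is relative so that it passes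
to occupancy measures, which are monotone and linear in the initial law. -/
theorem abs_softmax_sub_le [Nonempty S] {σ r : ℝ} (hσ : 0 < σ) {V W : S → ℝ}
    (h : ∀ s, |W s - V s| ≤ r) (hr : 2 * σ * r ≤ 1) (s : S) :
    |(softmax σ W s).toReal - (softmax σ V s).toReal| ≤ 4 * σ * r * (softmax σ V s).toReal := by
  have hr0 : 0 ≤ r := (abs_nonneg _).trans (h s)
  have hform : ∀ U : S → ℝ, (softmax σ U s).toReal = Real.exp (σ * (U s - lse σ U)) := fun U => by
    rw [softmax_toReal, ← exp_mul_lse hσ, ← Real.exp_sub, mul_sub]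
  have hd : ∀ U U' : S → ℝ, (∀ s, |U s - U' s| ≤ r) → lse σ U ≤ lse σ U' + r := fun U U' hU =>
    (lse_le_add_dist hσ U U').trans (add_le_add_right ((dist_pi_le_iff hr0).2 hU) _)
  have h1 := hd W V h
  have h2 := hd V W fun s => by rw [abs_sub_comm]; exact h s
  have h3 := abs_le.1 (h s)
  set x := σ * (W s - lse σ W) - σ * (V s - lse σ V) with hx
  have hx1 : |x| ≤ 2 * σ * r := by
    rw [hx, ← mul_sub, abs_mul, abs_of_pos hσ]
    have : |W s - lse σ W - (V s - lse σ V)| ≤ 2 * r := abs_le.2 ⟨by linarith, by linarith⟩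
    nlinarith
  have hW : (softmax σ W s).toReal = (softmax σ V s).toReal * Real.exp x := by
    rw [hform, hform, ← Real.exp_add]; congr 1; rw [hx]; ring
  rw [hW, ← mul_sub_one, abs_mul, abs_of_nonneg ENNReal.toReal_nonneg, mul_comm]
  refine mul_le_mul_of_nonneg_right ?_ ENNReal.toReal_nonneg
  have := Real.abs_exp_sub_one_le (hx1.trans hr)
  linarith

end LogSumExp

/-! ### Policies, occupancy measures and visitation measures. -/

theorem Policy.nonneg {S A : Type*} [Fintype A] (θ : Policy S A) (s : S) (a : A) :
    0 ≤ θ.1 (s, a) := (θ.2 s).1 a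

theorem Policy.sum_eq_one {S A : Type*} [Fintype A] (θ : Policy S A) (s : S) :
    ∑ a, θ.1 (s, a) = 1 := (θ.2 s).2

theorem Policy.le_one {S A : Type*} [Fintype A] (θ : Policy S A) (s : S) (a : A) :
    θ.1 (s, a) ≤ 1 := by
  rw [← θ.sum_eq_one s]
  exact Finset.single_le_sum (f := fun a => θ.1 (s, a)) (fun a _ => θ.nonneg s a)
    (Finset.mem_univ a)

theorem Policy.act_toReal {S A : Type*} [Fintype A] (θ : Policy S A) (s : S) (a : A) :
    (θ.act s a).toReal = θ.1 (s, a) := by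
  unfold Policy.act
  rw [PMF.ofFintype_apply, ENNReal.toReal_ofReal (θ.nonneg s a)]

theorem geometricPMF_toReal {p : ℝ} (hp0 : 0 < p) (hp1 : p ≤ 1) (k : ℕ) :
    (geometricPMF p hp0 hp1 k).toReal = p * (1 - p) ^ k :=
  ENNReal.toReal_ofReal (mul_nonneg hp0.le (pow_nonneg (by linarith) k))

namespace RobustMDP

section

variable {S A : Type*} (m : RobustMDP S A)

theorem p_nonneg (s : S) (a : A) (s' : S) : 0 ≤ m.p s a s' := ENNReal.toReal_nonneg

theorem one_sub_γ_pos : 0 < 1 - m.γ := sub_pos.2 m.γ_lt_one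

theorem one_sub_R_nonneg : 0 ≤ 1 - m.R := sub_nonneg.2 m.R_le_one

theorem γR_div_nonneg : 0 ≤ m.γ * m.R / (1 - m.γ) :=
  div_nonneg (mul_nonneg m.γ_nonneg m.R_nonneg) m.one_sub_γ_pos.le

theorem one_div_δ_add : 1 / m.δ + m.γ * m.R / (1 - m.γ) * (1 / m.δ) = 1 / (1 - m.γ) := by
  have h1 := m.δ_pos.ne'
  have h2 := m.one_sub_γ_pos.ne'
  field_simp
  unfold δ; ring

end

variable {S A : Type*} [Fintype S] [Fintype A] (m : RobustMDP S A)

/-- The nominal transition operator of the policy `π_θ`. -/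
noncomputable def transition (θ : Policy S A) (u : S → ℝ) (s : S) : ℝ :=
  ∑ a, θ.1 (s, a) * ∑ s', m.p s a s' * u s'

theorem transition_mono (θ : Policy S A) {u v : S → ℝ} {s : S} (h : ∀ s, u s ≤ v s) :
    m.transition θ u s ≤ m.transition θ v s :=
  Finset.sum_le_sum fun a _ => mul_le_mul_of_nonneg_left
    (Finset.sum_le_sum fun s' _ => mul_le_mul_of_nonneg_left (h s') (m.p_nonneg _ _ _))
    (θ.nonneg s a)

theorem transition_const (θ : Policy S A) (x : ℝ) (s : S) :
    m.transition θ (fun _ => x) s = x := by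
  unfold transition
  simp only [← Finset.sum_mul, m.sum_p, one_mul, θ.sum_eq_one]

theorem expect_walk_succ (θ : Policy S A) (n : ℕ) (s : S) (u : S → ℝ) :
    expect (m.walk θ (n + 1) s) u = m.transition θ (fun s' => expect (m.walk θ n s') u) s := by
  rw [walk, expect_bind (bddOn_finite _ _), expect_fintype]
  refine Finset.sum_congr rfl fun a _ => ?_
  rw [expect_bind (bddOn_finite _ _), expect_fintype, θ.act_toReal]
  rfl

theorem expect_walk_succ' (θ : Policy S A) (n : ℕ) (s : S) (u : S → ℝ) :
    expect (m.walk θ (n + 1) s) u = expect (m.walk θ n s) (m.transition θ u) := by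
  induction n generalizing s with
  | zero => rw [expect_walk_succ]; simp only [walk, expect_pure]
  | succ n ih => rw [expect_walk_succ, expect_walk_succ]; simp only [ih]

/-- The law of the state at a geometric time of the nominal chain started from `μ`. -/
noncomputable def stopped (θ : Policy S A) (μ : PMF S) : PMF S :=
  (geometricPMF m.δ m.δ_pos m.δ_le_one).bind fun T => μ.bind (m.walk θ T)

/-- The discounted occupancy measure of the nominal chain started from `μ`, with discount factor
`γ (1 - R)`. -/
noncomputable def occupancy (θ : Policy S A) (μ : PMF S) (s : S) : ℝ :=
  1 / m.δ * (m.stopped θ μ s).toReal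

theorem occupancy_nonneg (θ : Policy S A) (μ : PMF S) (s : S) : 0 ≤ m.occupancy θ μ s :=
  mul_nonneg (one_div_nonneg.2 m.δ_pos.le) ENNReal.toReal_nonneg

theorem sum_occupancy (θ : Policy S A) (μ : PMF S) : ∑ s, m.occupancy θ μ s = 1 / m.δ := by
  unfold occupancy
  rw [← Finset.mul_sum, sum_toReal_pmf, mul_one]

/-- The geometric time has weights δ(1-δ)^k; the factor 1/δ in `occupancy` turns them into the
discount weights (1-δ)^k with 1-δ = γ(1-R). -/
theorem hasSum_occupancy (θ : Policy S A) (μ : PMF S) (u : S → ℝ) :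
    HasSum (fun k : ℕ => (1 - m.δ) ^ k * expect μ fun s => expect (m.walk θ k s) u)
      (∑ s, m.occupancy θ μ s * u s) := by
  have hb : BddOn (m.stopped θ μ) u := bddOn_finite _ _
  have hs := (BddOn.expect_bind hb).summable.hasSum.mul_left (1 / m.δ)
  have h : ∑ s, m.occupancy θ μ s * u s = 1 / m.δ * expect (m.stopped θ μ) u := by
    rw [expect_fintype, Finset.mul_sum]
    exact Finset.sum_congr rfl fun s _ => by unfold occupancy; ring
  have hk : (fun k : ℕ => (1 - m.δ) ^ k * expect μ fun s => expect (m.walk θ k s) u) = fun k =>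
      1 / m.δ * ((geometricPMF m.δ m.δ_pos m.δ_le_one k).toReal *
        expect (μ.bind (m.walk θ k)) u) := by
    funext k
    rw [geometricPMF_toReal, expect_bind (bddOn_finite _ _)]
    have := m.δ_pos.ne'
    field_simp
  rw [h, stopped, expect_bind hb, hk]
  exact hs

/-- The occupancy measure is μ applied to the Neumann series of γ(1-R)P, which inverts I - γ(1-R)P.
-/
theorem sum_occupancy_mul_sub (θ : Policy S A) (μ : PMF S) (u : S → ℝ) :
    ∑ s, m.occupancy θ μ s * (u s - m.γ * (1 - m.R) * m.transition θ u s) =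
      ∑ s, (μ s).toReal * u s := by
  have h1 := m.hasSum_occupancy θ μ u
  have h2 := (m.hasSum_occupancy θ μ (m.transition θ u)).mul_left (1 - m.δ)
  have h3 := (hasSum_nat_add_iff' 1).2 h1
  have hk : (fun k : ℕ => (1 - m.δ) *
      ((1 - m.δ) ^ k * expect μ fun s => expect (m.walk θ k s) (m.transition θ u))) =
      fun k => (1 - m.δ) ^ (k + 1) * expect μ fun s => expect (m.walk θ (k + 1) s) u := by
    funext k
    simp only [m.expect_walk_succ']
    ring
  rw [hk] at h2
  have h4 := h2.unique h3
  have hδ : 1 - m.δ = m.γ * (1 - m.R) := by unfold δ; ring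
  simp only [Finset.sum_range_one, pow_zero, one_mul, walk, expect_pure, hδ] at h4
  rw [expect_fintype] at h4
  have h5 : ∑ s, m.occupancy θ μ s * (u s - m.γ * (1 - m.R) * m.transition θ u s) =
      ∑ s, m.occupancy θ μ s * u s
        - m.γ * (1 - m.R) * ∑ s, m.occupancy θ μ s * m.transition θ u s := by
    rw [Finset.mul_sum, ← Finset.sum_sub_distrib]
    exact Finset.sum_congr rfl fun s _ => by ring
  rw [h5, h4]; ring

theorem hasSum_occupancy_apply [DecidableEq S] (θ : Policy S A) (μ : PMF S) (s : S) :
    HasSum (fun k : ℕ => (1 - m.δ) ^ k * ∑ i, (μ i).toReal * (m.walk θ k i s).toReal)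
      (m.occupancy θ μ s) := by
  have h := m.hasSum_occupancy θ μ (Pi.single s 1)
  simpa [expect_fintype, Pi.single_apply] using h

theorem le_occupancy [DecidableEq S] (θ : Policy S A) (μ : PMF S) (s : S) :
    (μ s).toReal ≤ m.occupancy θ μ s := by
  have h0 := le_hasSum (m.hasSum_occupancy_apply θ μ s) 0 fun k _ => mul_nonneg
    (pow_nonneg (sub_nonneg.2 m.δ_le_one) k)
    (Finset.sum_nonneg fun i _ => mul_nonneg ENNReal.toReal_nonneg ENNReal.toReal_nonneg)
  simpa [walk, PMF.pure_apply, apply_ite] using h0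

theorem mul_occupancy_le [DecidableEq S] (θ : Policy S A) {μ ν : PMF S} {x y : ℝ}
    (h : ∀ i, x * (μ i).toReal ≤ y * (ν i).toReal) (s : S) :
    x * m.occupancy θ μ s ≤ y * m.occupancy θ ν s := by
  refine hasSum_le (fun k => ?_) ((m.hasSum_occupancy_apply θ μ s).mul_left x)
    ((m.hasSum_occupancy_apply θ ν s).mul_left y)
  rw [mul_left_comm x, mul_left_comm y]
  refine mul_le_mul_of_nonneg_left ?_ (pow_nonneg (sub_nonneg.2 m.δ_le_one) k)
  rw [Finset.mul_sum, Finset.mul_sum]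
  refine Finset.sum_le_sum fun i _ => ?_
  rw [← mul_assoc, ← mul_assoc]
  exact mul_le_mul_of_nonneg_right (h i) ENNReal.toReal_nonneg

/-- The discounted occupancy measure of the chain which moves with the nominal kernel with
probability `1 - R`, and is redrawn from `η` with probability `R`. -/
noncomputable def visitation (θ : Policy S A) (η : PMF S) (s : S) : ℝ :=
  m.occupancy θ m.ρ s + m.γ * m.R / (1 - m.γ) * m.occupancy θ η s

theorem le_visitation [DecidableEq S] (θ : Policy S A) (η : PMF S) (s : S) :
    (m.ρ s).toReal ≤ m.visitation θ η s := by
  have h1 := m.le_occupancy θ m.ρ s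
  have h2 := mul_nonneg m.γR_div_nonneg (m.occupancy_nonneg θ η s)
  unfold visitation
  linarith

theorem visitation_nonneg (θ : Policy S A) (η : PMF S) (s : S) : 0 ≤ m.visitation θ η s :=
  add_nonneg (m.occupancy_nonneg _ _ _) (mul_nonneg m.γR_div_nonneg (m.occupancy_nonneg _ _ _))

theorem sum_visitation (θ : Policy S A) (η : PMF S) :
    ∑ s, m.visitation θ η s = 1 / (1 - m.γ) := by
  unfold visitation
  rw [Finset.sum_add_distrib, ← Finset.mul_sum, m.sum_occupancy, m.sum_occupancy, one_div_δ_add]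

theorem visitation_le (θ : Policy S A) (η : PMF S) (s : S) :
    m.visitation θ η s ≤ 1 / (1 - m.γ) := by
  rw [← m.sum_visitation θ η]
  exact Finset.single_le_sum (f := m.visitation θ η) (fun s _ => m.visitation_nonneg θ η s)
    (Finset.mem_univ s)

/-- The visitation measure solves ν(I - γ(1-R)P_θ - γR·1⊗η) = ρ. This dictates the weight of the
η-part: a total mass of 1/(1-γ) redraws at rate γR. -/
theorem sum_visitation_mul_sub (θ : Policy S A) (η : PMF S) (u : S → ℝ) :
    ∑ s, m.visitation θ η s * (u s - m.γ * (1 - m.R) * m.transition θ u s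
      - m.γ * m.R * ∑ s', (η s').toReal * u s') = ∑ s, (m.ρ s).toReal * u s := by
  have h1 := m.sum_occupancy_mul_sub θ m.ρ u
  have h2 := m.sum_occupancy_mul_sub θ η u
  set x := ∑ s', (η s').toReal * u s'
  have h3 : ∑ s, m.visitation θ η s * (m.γ * m.R * x) = m.γ * m.R / (1 - m.γ) * x := by
    rw [← Finset.sum_mul, m.sum_visitation]; ring
  have h4 : ∑ s, m.visitation θ η s * (u s - m.γ * (1 - m.R) * m.transition θ u s) =
      ∑ s, (m.ρ s).toReal * u s + m.γ * m.R / (1 - m.γ) * x := by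
    rw [← h1, ← h2, Finset.mul_sum, ← Finset.sum_add_distrib]
    exact Finset.sum_congr rfl fun s _ => by unfold visitation; ring
  simp only [mul_sub (m.visitation θ η _) (u _ - _) _, Finset.sum_sub_distrib]
  rw [h3, h4]; ring

/-- A performance-difference inequality. Positivity of the visitation measure is what allows an
inequality in place of an exact recursion, and so absorbs the nonlinearity of log-sum-exp. -/
theorem sum_mul_le_of_le (θ : Policy S A) (η : PMF S) {u f : S → ℝ}
    (h : ∀ s, u s ≤ f s + m.γ * (1 - m.R) * m.transition θ u s
      + m.γ * m.R * ∑ s', (η s').toReal * u s') :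
    ∑ s, (m.ρ s).toReal * u s ≤ ∑ s, m.visitation θ η s * f s := by
  rw [← m.sum_visitation_mul_sub θ η u]
  refine Finset.sum_le_sum fun s _ =>
    mul_le_mul_of_nonneg_left ?_ (m.visitation_nonneg _ _ _)
  have := h s
  linarith

end RobustMDP

/-- The policy which plays the action `f s` in the state `s`. -/
noncomputable def deterministic {S A : Type*} [Fintype A] [DecidableEq A] (f : S → A) :
    Policy S A :=
  ⟨WithLp.toLp 2 fun x => if x.2 = f x.1 then 1 else 0, fun s =>
    ⟨fun a => by dsimp; split_ifs <;> norm_num, by simp⟩⟩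

theorem sum_deterministic_mul {S A : Type*} [Fintype A] [DecidableEq A] (f : S → A) (s : S)
    (g : A → ℝ) : ∑ a, (deterministic f).1 (s, a) * g a = g (f s) := by
  simp [deterministic]

theorem abs_sum_sub_mul_le {S A : Type*} [Fintype S] [Fintype A] (θ θ' : Policy S A) (s : S)
    {f : A → ℝ} {C : ℝ} (hf : ∀ a, |f a| ≤ C) :
    |∑ a, (θ'.1 (s, a) - θ.1 (s, a)) * f a| ≤ Fintype.card A * C * ‖θ'.1 - θ.1‖ := by
  calc _ ≤ ∑ a, |(θ'.1 (s, a) - θ.1 (s, a)) * f a| := Finset.abs_sum_le_sum_abs _ _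
    _ ≤ ∑ _a : A, ‖θ'.1 - θ.1‖ * C := by
        refine Finset.sum_le_sum fun a _ => ?_
        rw [abs_mul]
        exact mul_le_mul (PiLp.norm_apply_le (θ'.1 - θ.1) (s, a)) (hf a) (abs_nonneg _)
          (norm_nonneg _)
    _ = _ := by rw [Finset.sum_const, Finset.card_univ, nsmul_eq_mul]; ring

namespace RobustMDP

/-! ### Lower bounds for C_σ and L_σ. -/

section Constants

variable {S A : Type*} [Fintype S] [Fintype A] (m : RobustMDP S A)

theorem log_card_div_nonneg {σ : ℝ} (hσ : 0 < σ) : 0 ≤ Real.log (Fintype.card S) / σ :=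
  div_nonneg (Real.log_natCast_nonneg _) hσ.le

theorem one_div_le_Cσ {σ : ℝ} (hσ : 0 < σ) : 1 / (1 - m.γ) ≤ m.Cσ σ := by
  have h1 := one_div_pos.2 m.one_sub_γ_pos
  have h2 := mul_nonneg (mul_nonneg m.γ_nonneg m.R_nonneg) (log_card_div_nonneg (S := S) hσ)
  unfold Cσ
  nlinarith

theorem Cσ_pos {σ : ℝ} (hσ : 0 < σ) : 0 < m.Cσ σ :=
  (one_div_pos.2 m.one_sub_γ_pos).trans_le (m.one_div_le_Cσ hσ)

theorem one_le_card_real (A : Type*) [Fintype A] [Nonempty A] : (1 : ℝ) ≤ Fintype.card A := by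
  exact_mod_cast Fintype.card_pos

/-- Puts L_σ in the shape that the smoothness estimate produces: √|S| and |S| are lowered to 1, and
the two copies of k_B combine by 1 + γR/(1-γ) = δ/(1-γ). -/
theorem le_Lσ [Nonempty S] [Nonempty A] {σ : ℝ} (hσ : 0 < σ) :
    (Fintype.card A : ℝ) ^ 2 * m.Cσ σ / (1 - m.γ) ^ 2 +
      2 * (Fintype.card A : ℝ) ^ 2 * m.γ * (1 - m.R) * m.Cσ σ / (m.δ * (1 - m.γ)) +
      m.γ * m.R * (2 * σ * (Fintype.card A : ℝ) ^ 2 * m.Cσ σ ^ 2) / ((1 - m.γ) ^ 2 * m.δ) ≤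
    m.Lσ σ := by
  have hC := m.Cσ_pos hσ
  have hδ := m.δ_pos
  have hγ := m.one_sub_γ_pos
  have hA := one_le_card_real A
  have hS := one_le_card_real S
  have hR := m.one_sub_R_nonneg
  have hγ0 := m.γ_nonneg
  have hg := m.γR_div_nonneg
  set C := m.Cσ σ
  set a := (Fintype.card A : ℝ)
  set n := (Fintype.card S : ℝ)
  have hCV : m.CVσ σ = a * C / (1 - m.γ) := by unfold CVσ; ring
  have hkB : m.kB σ = a ^ 2 * C / (m.δ * (1 - m.γ)) + 2 * a ^ 2 * m.γ * (1 - m.R) * C / m.δ ^ 2 := by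
    unfold kB; rw [hCV]; field_simp; ring
  have hkB0 : 0 ≤ m.kB σ := by rw [hkB]; positivity
  have hs : 1 ≤ Real.sqrt n := by rw [Real.one_le_sqrt]; exact hS
  have hX : 2 * σ * a ^ 2 * C ^ 2 / ((1 - m.γ) * m.δ) ≤
      2 * σ * n * m.CVσ σ * (1 / m.δ) * a * C := by
    have : 2 * σ * n * m.CVσ σ * (1 / m.δ) * a * C =
        n * (2 * σ * a ^ 2 * C ^ 2 / ((1 - m.γ) * m.δ)) := by
      rw [hCV]; field_simp
    rw [this]
    exact le_mul_of_one_le_left (by positivity) hS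
  have h1 : m.kB σ + m.γ * m.R / (1 - m.γ) *
      (1 * m.kB σ + 2 * σ * a ^ 2 * C ^ 2 / ((1 - m.γ) * m.δ)) ≤ m.Lσ σ := by
    unfold Lσ
    gcongr
  refine le_trans (le_of_eq ?_) h1
  have h2 : 1 + m.γ * m.R / (1 - m.γ) = m.δ / (1 - m.γ) := by
    field_simp; unfold δ; ring
  have h3 : m.kB σ + m.γ * m.R / (1 - m.γ) *
      (1 * m.kB σ + 2 * σ * a ^ 2 * C ^ 2 / ((1 - m.γ) * m.δ)) =
      m.kB σ * (1 + m.γ * m.R / (1 - m.γ)) +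
      m.γ * m.R / (1 - m.γ) * (2 * σ * a ^ 2 * C ^ 2 / ((1 - m.γ) * m.δ)) := by ring
  rw [h3, h2, hkB]
  field_simp

theorem one_le_Lσ [Nonempty S] [Nonempty A] {σ : ℝ} (hσ : 0 < σ) : 1 ≤ m.Lσ σ := by
  refine le_trans ?_ (m.le_Lσ (A := A) hσ)
  have hC := m.Cσ_pos hσ
  have hδ := m.δ_pos
  have hγ := m.one_sub_γ_pos
  have hR := m.one_sub_R_nonneg
  have hR0 := m.R_nonneg
  have hγ0 := m.γ_nonneg
  have hA := one_le_card_real A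
  have h1 : 1 ≤ 1 / (1 - m.γ) := by
    rw [one_le_div hγ]; linarith
  have h2 : 1 ≤ m.Cσ σ := h1.trans (m.one_div_le_Cσ hσ)
  have h3 : 1 ≤ (Fintype.card A : ℝ) ^ 2 * m.Cσ σ / (1 - m.γ) ^ 2 := by
    rw [one_le_div (by positivity)]
    have : (1 - m.γ) ^ 2 ≤ 1 := by nlinarith
    have : 1 ≤ (Fintype.card A : ℝ) ^ 2 * m.Cσ σ := one_le_mul_of_one_le_of_one_le
      (one_le_pow₀ hA) h2
    linarith
  have h4 : 0 ≤ 2 * (Fintype.card A : ℝ) ^ 2 * m.γ * (1 - m.R) * m.Cσ σ / (m.δ * (1 - m.γ)) := by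
    positivity
  have h5 : 0 ≤ m.γ * m.R * (2 * σ * (Fintype.card A : ℝ) ^ 2 * m.Cσ σ ^ 2) /
      ((1 - m.γ) ^ 2 * m.δ) := by positivity
  linarith

end Constants

/-! ### Smoothed values: bounds, smoothness and gradient domination. -/

variable {S A : Type*} [Fintype S] [DecidableEq S] [Nonempty S] [Fintype A] [DecidableEq A]
variable (m : RobustMDP S A)

theorem avg_smoothedQ {σ : ℝ} (hσ : 0 < σ) (θ : Policy S A) :
    θ.avg (m.smoothedQ σ θ) = m.smoothedValue σ θ :=
  Classical.epsilon_spec (p := fun V => m.smoothedBellman σ θ V = V)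
    (m.existsUnique_smoothedValue hσ θ).exists

theorem sum_p_mul_le (s : S) (a : A) {u : S → ℝ} {b : ℝ} (h : ∀ s, u s ≤ b) :
    ∑ s', m.p s a s' * u s' ≤ b := by
  calc _ ≤ ∑ s', m.p s a s' * b :=
        Finset.sum_le_sum fun s' _ => mul_le_mul_of_nonneg_left (h s') (m.p_nonneg _ _ _)
    _ = b := by rw [← Finset.sum_mul, m.sum_p, one_mul]

theorem le_sum_p_mul (s : S) (a : A) {u : S → ℝ} {b : ℝ} (h : ∀ s, b ≤ u s) :
    b ≤ ∑ s', m.p s a s' * u s' := by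
  calc b = ∑ s', m.p s a s' * b := by rw [← Finset.sum_mul, m.sum_p, one_mul]
    _ ≤ _ := Finset.sum_le_sum fun s' _ => mul_le_mul_of_nonneg_left (h s') (m.p_nonneg _ _ _)

theorem avg_le (θ : Policy S A) {Q : QTable S A} {s : S} {b : ℝ} (h : ∀ a, Q s a ≤ b) :
    θ.avg Q s ≤ b := by
  calc _ ≤ ∑ a, θ.1 (s, a) * b :=
        Finset.sum_le_sum fun a _ => mul_le_mul_of_nonneg_left (h a) (θ.nonneg _ _)
    _ = b := by rw [← Finset.sum_mul, θ.sum_eq_one, one_mul]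

theorem le_avg (θ : Policy S A) {Q : QTable S A} {s : S} {b : ℝ} (h : ∀ a, b ≤ Q s a) :
    b ≤ θ.avg Q s := by
  calc b = ∑ a, θ.1 (s, a) * b := by rw [← Finset.sum_mul, θ.sum_eq_one, one_mul]
    _ ≤ _ := Finset.sum_le_sum fun a _ => mul_le_mul_of_nonneg_left (h a) (θ.nonneg _ _)

theorem lookahead_le {σ : ℝ} (hσ : 0 < σ) {V : S → ℝ} {b : ℝ} (h : ∀ s, V s ≤ b) (s : S) (a : A) :
    m.lookahead σ V s a ≤ 1 + m.γ * b + m.γ * m.R * (Real.log (Fintype.card S) / σ) := by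
  have h1 := mul_le_mul_of_nonneg_left (m.sum_p_mul_le s a h)
    (mul_nonneg m.γ_nonneg m.one_sub_R_nonneg)
  have h2 := mul_le_mul_of_nonneg_left (lse_le_add_log hσ h) (mul_nonneg m.γ_nonneg m.R_nonneg)
  have h3 := m.c_le_one s a
  unfold lookahead
  linarith

theorem le_lookahead {σ : ℝ} (hσ : 0 < σ) {V : S → ℝ} {b : ℝ} (h : ∀ s, b ≤ V s) (s : S) (a : A) :
    m.γ * b ≤ m.lookahead σ V s a := by
  have h1 := mul_le_mul_of_nonneg_left (m.le_sum_p_mul s a h)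
    (mul_nonneg m.γ_nonneg m.one_sub_R_nonneg)
  have h2 := mul_le_mul_of_nonneg_left ((h s).trans (le_lse hσ V s))
    (mul_nonneg m.γ_nonneg m.R_nonneg)
  have h3 := m.c_nonneg s a
  unfold lookahead
  linarith

/-- Minimum principle: at a minimizing state the fixed-point equation gives V ≥ γV. The upper bound
in `smoothedQ_le` uses a maximizing state in the same way. -/
theorem smoothedValue_nonneg {σ : ℝ} (hσ : 0 < σ) (θ : Policy S A) (s : S) :
    0 ≤ m.smoothedValue σ θ s := by
  obtain ⟨s₀, hs₀⟩ := Finite.exists_min (m.smoothedValue σ θ)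
  have h := le_avg θ fun a => m.le_lookahead hσ hs₀ s₀ a
  have h' := congrFun (m.avg_smoothedQ hσ θ) s₀
  unfold smoothedQ at h'
  rw [h'] at h
  have := m.one_sub_γ_pos
  have h0 : 0 ≤ m.smoothedValue σ θ s₀ := by
    by_contra! hneg
    nlinarith
  exact h0.trans (hs₀ s)

theorem smoothedQ_nonneg {σ : ℝ} (hσ : 0 < σ) (θ : Policy S A) (s : S) (a : A) :
    0 ≤ m.smoothedQ σ θ s a := by
  simpa [smoothedQ] using m.le_lookahead hσ (m.smoothedValue_nonneg hσ θ) s a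

theorem smoothedQ_le {σ : ℝ} (hσ : 0 < σ) (θ : Policy S A) (s : S) (a : A) :
    m.smoothedQ σ θ s a ≤ m.Cσ σ := by
  obtain ⟨s₀, hs₀⟩ := Finite.exists_max (m.smoothedValue σ θ)
  have h := avg_le θ fun a => m.lookahead_le hσ hs₀ s₀ a
  have h' := congrFun (m.avg_smoothedQ hσ θ) s₀
  have hq := m.lookahead_le hσ hs₀ s a
  unfold smoothedQ at h' ⊢
  rw [h'] at h
  refine hq.trans ?_
  have hγ := m.one_sub_γ_pos
  have hl := mul_nonneg (mul_nonneg m.γ_nonneg m.R_nonneg) (log_card_div_nonneg (S := S) hσ)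
  have hγ0 := m.γ_nonneg
  unfold Cσ
  rw [one_div_mul_eq_div, le_div_iff₀ hγ]
  nlinarith

theorem smoothedValue_le {σ : ℝ} (hσ : 0 < σ) (θ : Policy S A) (s : S) :
    m.smoothedValue σ θ s ≤ m.Cσ σ := by
  rw [← m.avg_smoothedQ hσ]
  exact avg_le θ fun a => m.smoothedQ_le hσ θ s a

/-- The recursion feeding `sum_mul_le_of_le`: the policy change is weighed by Q at `θ`, the
propagation follows `θ'`, and log-sum-exp is left unlinearized. -/
theorem smoothedValue_sub_eq {σ : ℝ} (hσ : 0 < σ) (θ θ' : Policy S A) (s : S) :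
    m.smoothedValue σ θ' s - m.smoothedValue σ θ s =
      ∑ a, (θ'.1 (s, a) - θ.1 (s, a)) * m.smoothedQ σ θ s a +
      m.γ * (1 - m.R) *
        m.transition θ' (fun s => m.smoothedValue σ θ' s - m.smoothedValue σ θ s) s +
      m.γ * m.R * (lse σ (m.smoothedValue σ θ') - lse σ (m.smoothedValue σ θ)) := by
  have h1 := congrFun (m.avg_smoothedQ hσ θ) s
  have h2 := congrFun (m.avg_smoothedQ hσ θ') s
  set x := m.γ * m.R * (lse σ (m.smoothedValue σ θ') - lse σ (m.smoothedValue σ θ)) with hx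
  have h3 : x = ∑ a, θ'.1 (s, a) * x := by rw [← Finset.sum_mul, θ'.sum_eq_one, one_mul]
  rw [h3, ← h1, ← h2]
  unfold Policy.avg transition
  rw [Finset.mul_sum, ← Finset.sum_add_distrib, ← Finset.sum_add_distrib, ← Finset.sum_sub_distrib]
  refine Finset.sum_congr rfl fun a _ => ?_
  simp only [mul_sub (m.p s a _), Finset.sum_sub_distrib]
  rw [hx]
  unfold smoothedQ lookahead
  ring

/-- The oscillation of the difference of two smoothed value functions. -/
theorem exists_osc_smoothedValue_sub_le {σ : ℝ} (hσ : 0 < σ) (θ θ' : Policy S A) :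
    ∃ a b, a ≤ b ∧ (∀ s, m.smoothedValue σ θ' s - m.smoothedValue σ θ s ∈ Set.Icc a b) ∧
      m.δ * (b - a) ≤ 2 * (Fintype.card A * m.Cσ σ * ‖θ'.1 - θ.1‖) := by
  set u := fun s => m.smoothedValue σ θ' s - m.smoothedValue σ θ s with hu
  -- Subtract the recursions at the two extremal states: the log-sum-exp increment does not depend
  -- on the state and cancels, leaving the contraction factor γ(1-R) = 1-δ. Hence oscillations cost
  -- only 1/δ.
  obtain ⟨i, hi⟩ := Finite.exists_min u
  obtain ⟨j, hj⟩ := Finite.exists_max u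
  refine ⟨u i, u j, hi j, fun s => ⟨hi s, hj s⟩, ?_⟩
  have hb : ∀ s, |∑ a, (θ'.1 (s, a) - θ.1 (s, a)) * m.smoothedQ σ θ s a| ≤
      Fintype.card A * m.Cσ σ * ‖θ'.1 - θ.1‖ := fun s => abs_sum_sub_mul_le θ θ' s fun a => by
    rw [abs_of_nonneg (m.smoothedQ_nonneg hσ θ s a)]
    exact m.smoothedQ_le hσ θ s a
  have h1 := abs_le.1 (hb i)
  have h2 := abs_le.1 (hb j)
  have e1 := m.smoothedValue_sub_eq hσ θ θ' i
  have e2 := m.smoothedValue_sub_eq hσ θ θ' j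
  have t1 := m.transition_mono θ' (s := i) hi
  have t2 := m.transition_mono θ' (s := j) hj
  rw [m.transition_const] at t1 t2
  have hg := mul_nonneg m.γ_nonneg m.one_sub_R_nonneg
  have t1' := mul_le_mul_of_nonneg_left t1 hg
  have t2' := mul_le_mul_of_nonneg_left t2 hg
  have e1' : u i = _ := e1
  have e2' : u j = _ := e2
  have hδ : m.δ = 1 - m.γ * (1 - m.R) := by unfold δ; ring
  rw [hδ]
  linarith

/-- The smoothed objective. -/
noncomputable def smoothedJ (σ : ℝ) (θ : Policy S A) : ℝ :=
  ∑ s, (m.ρ s).toReal * m.smoothedValue σ θ s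

/-- The gradient of the smoothed objective. -/
noncomputable def smoothedGrad (σ : ℝ) (θ : Policy S A) : EuclideanSpace ℝ (S × A) :=
  WithLp.toLp 2 fun x =>
    m.visitation θ (softmax σ (m.smoothedValue σ θ)) x.1 * m.smoothedQ σ θ x.1 x.2

theorem inner_smoothedGrad (σ : ℝ) (θ : Policy S A) (d : EuclideanSpace ℝ (S × A)) :
    inner ℝ (m.smoothedGrad σ θ) d =
      ∑ s, m.visitation θ (softmax σ (m.smoothedValue σ θ)) s *
        ∑ a, d (s, a) * m.smoothedQ σ θ s a := by
  rw [PiLp.inner_apply, Fintype.sum_prod_type]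
  refine Finset.sum_congr rfl fun s _ => ?_
  rw [Finset.mul_sum]
  refine Finset.sum_congr rfl fun a _ => ?_
  simp [smoothedGrad]
  ring

/-- The smoothed objective is `L_σ`-smooth. -/
theorem smoothedJ_le_add [Nonempty A] {σ : ℝ} (hσ : 0 < σ) (θ θ' : Policy S A) :
    m.smoothedJ σ θ' ≤ m.smoothedJ σ θ + inner ℝ (m.smoothedGrad σ θ) (θ'.1 - θ.1) +
      m.Lσ σ / 2 * ‖θ'.1 - θ.1‖ ^ 2 := by
  obtain ⟨a, b, hab, hu, hosc⟩ := m.exists_osc_smoothedValue_sub_le hσ θ θ'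
  set u := fun s => m.smoothedValue σ θ' s - m.smoothedValue σ θ s with hu_def
  set Δ := ‖θ'.1 - θ.1‖ with hΔ
  set N := (Fintype.card A : ℝ) with hN
  set C := m.Cσ σ with hC
  set η := softmax σ (m.smoothedValue σ θ) with hη
  have hδ := m.δ_pos
  have hγ := m.one_sub_γ_pos
  have hγ0 := m.γ_nonneg
  have hR := m.R_nonneg
  have hR1 := m.one_sub_R_nonneg
  have hC0 : 0 < C := m.Cσ_pos hσ
  have hΔ0 : 0 ≤ Δ := norm_nonneg _
  have hN0 : 0 ≤ N := Nat.cast_nonneg _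
  have hosc' : b - a ≤ 2 * (N * C * Δ / m.δ) := by
    rw [← mul_div_assoc, le_div_iff₀ hδ]; linarith
  have hlse : lse σ (m.smoothedValue σ θ') - lse σ (m.smoothedValue σ θ) ≤
      ∑ s, (η s).toReal * u s + σ / 2 * (N * C * Δ / m.δ) ^ 2 := by
    have h := lse_sub_le_sum_softmax_add hσ (m.smoothedValue σ θ) u hab hu
    have he : (fun s => m.smoothedValue σ θ s + u s) = m.smoothedValue σ θ' := by
      funext s; simp [u]
    rw [he] at h
    have h2 : (b - a) ^ 2 ≤ (2 * (N * C * Δ / m.δ)) ^ 2 :=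
      pow_le_pow_left₀ (sub_nonneg.2 hab) hosc' 2
    have h3 := mul_le_mul_of_nonneg_left h2 (by positivity : 0 ≤ σ / 8)
    linarith
  -- Replacing `θ'` by `θ` in the transition costs a second-order term. Both policies sum to 1, so u
  -- may be centred at (a+b)/2, which leaves half its oscillation, itself of order Δ.
  have htr : ∀ s, m.transition θ' u s ≤ m.transition θ u s + N * (N * C * Δ / m.δ) * Δ := by
    intro s
    have h := abs_sum_sub_mul_le θ θ' s (f := fun i => ∑ s', m.p s i s' * u s' - (a + b) / 2)
      (C := N * C * Δ / m.δ) fun i => by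
        have h1 := m.le_sum_p_mul s i fun s => (hu s).1
        have h2 := m.sum_p_mul_le s i fun s => (hu s).2
        exact abs_le.2 ⟨by linarith, by linarith⟩
    have he : ∑ i, (θ'.1 (s, i) - θ.1 (s, i)) * (∑ s', m.p s i s' * u s' - (a + b) / 2) =
        m.transition θ' u s - m.transition θ u s := by
      simp only [mul_sub, sub_mul, Finset.sum_sub_distrib, ← Finset.sum_mul, θ.sum_eq_one,
        θ'.sum_eq_one, transition]
      ring
    rw [he] at h
    have := (abs_le.1 h).2
    linarith
  set err := m.γ * (1 - m.R) * (N * (N * C * Δ / m.δ) * Δ) +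
    m.γ * m.R * (σ / 2 * (N * C * Δ / m.δ) ^ 2) with herr
  have hmain := m.sum_mul_le_of_le θ η (u := u)
    (f := fun s => ∑ a, (θ'.1 - θ.1) (s, a) * m.smoothedQ σ θ s a + err) fun s => by
      have h1 : u s = _ := m.smoothedValue_sub_eq hσ θ θ' s
      have h2 := mul_le_mul_of_nonneg_left (htr s) (mul_nonneg hγ0 hR1)
      have h3 := mul_le_mul_of_nonneg_left hlse (mul_nonneg hγ0 hR)
      rw [h1]
      simp only [PiLp.sub_apply]
      rw [herr]
      linarith
  simp only [mul_add, Finset.sum_add_distrib, ← Finset.sum_mul, m.sum_visitation] at hmain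
  rw [← m.inner_smoothedGrad] at hmain
  have hJ : ∑ s, (m.ρ s).toReal * u s = m.smoothedJ σ θ' - m.smoothedJ σ θ := by
    simp only [u, mul_sub, Finset.sum_sub_distrib, smoothedJ]
  rw [hJ] at hmain
  -- The error is multiplied by the total visitation mass. The last two summands of `le_Lσ` absorb
  -- it, the third using 1-γ ≤ δ; the first is slack.
  have hfin : 1 / (1 - m.γ) * err ≤ m.Lσ σ / 2 * Δ ^ 2 := by
    have hL := mul_le_mul_of_nonneg_right (m.le_Lσ hσ) (by positivity : 0 ≤ Δ ^ 2 / 2)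
    refine le_trans ?_ (hL.trans_eq (by ring))
    rw [← hC, ← hN]
    have e1 : 1 / (1 - m.γ) * err =
        2 * N ^ 2 * m.γ * (1 - m.R) * C / (m.δ * (1 - m.γ)) * (Δ ^ 2 / 2) +
        m.γ * m.R * (σ * N ^ 2 * C ^ 2) / ((1 - m.γ) * m.δ * m.δ) * (Δ ^ 2 / 2) := by
      rw [herr]; field_simp
    have e2 : m.γ * m.R * (σ * N ^ 2 * C ^ 2) / ((1 - m.γ) * m.δ * m.δ) ≤
        m.γ * m.R * (2 * σ * N ^ 2 * C ^ 2) / ((1 - m.γ) ^ 2 * m.δ) := by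
      have hδγ : 1 - m.γ ≤ m.δ := by
        have := mul_nonneg hγ0 hR
        unfold δ; linarith
      have hp : 0 ≤ m.γ * m.R * (σ * N ^ 2 * C ^ 2) := by positivity
      refine div_le_div₀ (by positivity) (by linarith) (by positivity) ?_
      rw [pow_two, mul_assoc, mul_assoc]
      exact mul_le_mul_of_nonneg_left (mul_le_mul_of_nonneg_right hδγ hδ.le) hγ.le
    have e3 : 0 ≤ N ^ 2 * C / (1 - m.γ) ^ 2 := by positivity
    rw [e1, add_mul, add_mul]
    have e4 := mul_le_mul_of_nonneg_right e2 (by positivity : 0 ≤ Δ ^ 2 / 2)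
    have e5 := mul_nonneg e3 (by positivity : 0 ≤ Δ ^ 2 / 2)
    linarith
  linarith

/-- Gradient domination: a first-order stationary point of the smoothed objective is a global
minimizer. -/
theorem smoothedJ_sub_le [Nonempty A] {σ : ℝ} (hσ : 0 < σ) (θ θ' : Policy S A) {r G : ℝ}
    (hr : 0 < r) (hρ : ∀ s, r ≤ (m.ρ s).toReal)
    (hG : ∀ θ'' : Policy S A, inner ℝ (m.smoothedGrad σ θ) (θ.1 - θ''.1) ≤ G) :
    m.smoothedJ σ θ - m.smoothedJ σ θ' ≤ 1 / ((1 - m.γ) * r) * G := by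
  set V := m.smoothedValue σ θ with hV
  set V' := m.smoothedValue σ θ' with hV'
  set η := softmax σ V with hη
  set u := fun s => V s - V' s with hu
  -- The greedy policy for Q is the comparison point: its statewise advantage g is nonnegative, so
  -- visitation measures can be exchanged under it.
  choose f hf using fun s => Finite.exists_min (m.smoothedQ σ θ s)
  set g := fun s => V s - m.smoothedQ σ θ s (f s) with hg
  have hVs : ∀ s, ∑ a, θ.1 (s, a) * m.smoothedQ σ θ s a = V s := fun s =>
    congrFun (m.avg_smoothedQ hσ θ) s
  have hgθ : ∀ s, ∑ a, (θ.1 - (deterministic f).1) (s, a) * m.smoothedQ σ θ s a = g s := by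
    intro s
    simp only [PiLp.sub_apply, sub_mul, Finset.sum_sub_distrib, hVs, sum_deterministic_mul, g]
  have hg0 : ∀ s, 0 ≤ g s := fun s => by
    have : m.smoothedQ σ θ s (f s) ≤ V s := by
      rw [← hVs]; exact le_avg θ (hf s)
    simpa [g] using this
  have hlse : lse σ V - lse σ V' ≤ ∑ s, (η s).toReal * u s := by
    have h := sum_softmax_le_lse_sub hσ V fun s => -u s
    have he : (fun s => V s + -u s) = V' := by funext s; simp [u]
    rw [he] at h
    simp only [mul_neg, Finset.sum_neg_distrib] at h
    linarith
  have hmain := m.sum_mul_le_of_le θ' η (u := u) (f := g) fun s => by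
    have h1 := m.smoothedValue_sub_eq hσ θ θ' s
    have h2 : m.transition θ' (fun s => m.smoothedValue σ θ' s - m.smoothedValue σ θ s) s =
        - m.transition θ' u s := by
      simp only [transition, u, hV, hV', ← Finset.sum_neg_distrib, ← mul_neg, neg_sub]
    have h3 := mul_le_mul_of_nonneg_left hlse (mul_nonneg m.γ_nonneg m.R_nonneg)
    have h4 : m.smoothedQ σ θ s (f s) ≤ ∑ a, θ'.1 (s, a) * m.smoothedQ σ θ s a :=
      le_avg θ' (hf s)
    rw [h2] at h1
    simp only [sub_mul, Finset.sum_sub_distrib, hVs] at h1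
    have h5 : u s = V s - V' s := rfl
    have h6 : g s = V s - m.smoothedQ σ θ s (f s) := rfl
    rw [← hV, ← hV'] at h1
    rw [h5, h6]
    linarith
  have hJ : ∑ s, (m.ρ s).toReal * u s = m.smoothedJ σ θ - m.smoothedJ σ θ' := by
    simp only [u, mul_sub, Finset.sum_sub_distrib, smoothedJ, hV, hV']
  have hγ := m.one_sub_γ_pos
  have hc : 0 ≤ 1 / ((1 - m.γ) * r) := by positivity
  rw [hJ] at hmain
  refine hmain.trans (le_trans ?_ (mul_le_mul_of_nonneg_left (hG (deterministic f)) hc))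
  rw [m.inner_smoothedGrad, Finset.mul_sum]
  refine Finset.sum_le_sum fun s _ => ?_
  rw [hgθ, ← mul_assoc]
  -- Change of measure: the visitation of `θ'` is at most 1/(1-γ), that of `θ` is at least ρ ≥ r.
  refine mul_le_mul_of_nonneg_right ((m.visitation_le θ' η s).trans ?_) (hg0 s)
  rw [one_div_mul_eq_div, div_le_div_iff₀ hγ (by positivity), one_mul, mul_comm]
  exact mul_le_mul_of_nonneg_right ((hρ s).trans (m.le_visitation θ _ s)) hγ.le

end RobustMDP

/-! ### Smoothing error: robust value against smoothed value. -/

namespace RobustMDP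

variable {S A : Type*} [Fintype S] [DecidableEq S] [Nonempty S] [Fintype A] [DecidableEq A]
variable (m : RobustMDP S A)

theorem uncertainty_nonneg {s : S} {a : A} {x : S → ℝ} (hx : x ∈ m.uncertainty s a) (s' : S) :
    0 ≤ x s' := by
  obtain ⟨q, hq, rfl⟩ := hx
  exact add_nonneg (mul_nonneg m.one_sub_R_nonneg (m.p_nonneg _ _ _))
    (mul_nonneg m.R_nonneg (hq.1 s'))

theorem stateDist_nonneg (κ : m.Nature) (θ : Policy S A) (s₀ : S) (t : ℕ) (s : S) :
    0 ≤ stateDist κ.1 θ s₀ t s := by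
  induction t generalizing s with
  | zero =>
    by_cases h : s = s₀
    · subst h; simp [stateDist]
    · simp [stateDist, h]
  | succ t ih =>
    exact Finset.sum_nonneg fun i _ => Finset.sum_nonneg fun a _ =>
      mul_nonneg (mul_nonneg (ih i) (θ.nonneg i a)) (m.uncertainty_nonneg (κ.2 t i a) s)

theorem sum_stateDist_succ_mul (κ : ℕ → S → A → S → ℝ) (θ : Policy S A) (s₀ : S) (t : ℕ)
    (V : S → ℝ) : ∑ s, stateDist κ θ s₀ (t + 1) s * V s =
      ∑ s, stateDist κ θ s₀ t s * ∑ a, θ.1 (s, a) * ∑ s', κ t s a s' * V s' := by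
  simp only [stateDist, Finset.sum_mul, Finset.mul_sum]
  rw [Finset.sum_comm]
  refine Finset.sum_congr rfl fun s _ => ?_
  rw [Finset.sum_comm]
  exact Finset.sum_congr rfl fun a _ => Finset.sum_congr rfl fun s' _ => by ring

theorem sum_uncertainty_mul {s : S} {a : A} {q : S → ℝ} (V : S → ℝ) :
    ∑ s', ((1 - m.R) * m.p s a s' + m.R * q s') * V s' =
      (1 - m.R) * ∑ s', m.p s a s' * V s' + m.R * ∑ s', q s' * V s' := by
  rw [Finset.mul_sum, Finset.mul_sum, ← Finset.sum_add_distrib]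
  exact Finset.sum_congr rfl fun s' _ => by ring

theorem sum_stateDist (κ : m.Nature) (θ : Policy S A) (s₀ : S) (t : ℕ) :
    ∑ s, stateDist κ.1 θ s₀ t s = 1 := by
  induction t with
  | zero => simp [stateDist]
  | succ t ih =>
    have h := sum_stateDist_succ_mul κ.1 θ s₀ t fun _ => 1
    have hκ : ∀ s a, ∑ s', κ.1 t s a s' * 1 = 1 := fun s a => by
      obtain ⟨q, hq, he⟩ := κ.2 t s a
      rw [he, m.sum_uncertainty_mul]
      simp [m.sum_p, hq.2]
    simp only [hκ] at h
    simpa [θ.sum_eq_one, ih] using h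

/-- The expected cost at time `t`. -/
noncomputable def stageCost (κ : ℕ → S → A → S → ℝ) (θ : Policy S A) (s₀ : S) (t : ℕ) : ℝ :=
  ∑ s, ∑ a, stateDist κ θ s₀ t s * θ.1 (s, a) * m.c s a

theorem stageCost_nonneg (κ : m.Nature) (θ : Policy S A) (s₀ : S) (t : ℕ) :
    0 ≤ m.stageCost κ.1 θ s₀ t :=
  Finset.sum_nonneg fun _ _ => Finset.sum_nonneg fun _ _ => mul_nonneg
    (mul_nonneg (m.stateDist_nonneg κ θ s₀ t _) (θ.nonneg _ _)) (m.c_nonneg _ _)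

theorem stageCost_add (κ : m.Nature) (θ : Policy S A) (s₀ : S) (t : ℕ) (V : S → ℝ) :
    m.stageCost κ.1 θ s₀ t + m.γ * ∑ s, stateDist κ.1 θ s₀ (t + 1) s * V s =
      ∑ s, stateDist κ.1 θ s₀ t s *
        θ.avg (fun s a => m.c s a + m.γ * ∑ s', κ.1 t s a s' * V s') s := by
  rw [sum_stateDist_succ_mul, stageCost, Finset.mul_sum, ← Finset.sum_add_distrib]
  refine Finset.sum_congr rfl fun s _ => ?_
  simp only [Policy.avg, Finset.mul_sum (s := (Finset.univ : Finset A))]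
  rw [← Finset.sum_add_distrib]
  exact Finset.sum_congr rfl fun a _ => by ring

theorem avg_mono (θ : Policy S A) {Q Q' : QTable S A} {s : S} (h : ∀ a, Q s a ≤ Q' s a) :
    θ.avg Q s ≤ θ.avg Q' s :=
  Finset.sum_le_sum fun a _ => mul_le_mul_of_nonneg_left (h a) (θ.nonneg s a)

/-- The smoothed value is a supersolution for every choice of nature, since q·V ≤ max V ≤ lse V for
any distribution q. Iteration gives the upper bound on all discounted costs. -/
theorem stageCost_add_le {σ : ℝ} (hσ : 0 < σ) (κ : m.Nature) (θ : Policy S A) (s₀ : S) (t : ℕ) :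
    m.stageCost κ.1 θ s₀ t +
      m.γ * ∑ s, stateDist κ.1 θ s₀ (t + 1) s * m.smoothedValue σ θ s ≤
      ∑ s, stateDist κ.1 θ s₀ t s * m.smoothedValue σ θ s := by
  rw [stageCost_add]
  refine Finset.sum_le_sum fun s _ =>
    mul_le_mul_of_nonneg_left ?_ (m.stateDist_nonneg κ θ s₀ t s)
  nth_rewrite 2 [← m.avg_smoothedQ hσ θ]
  refine avg_mono θ fun a => ?_
  obtain ⟨q, hq, he⟩ := κ.2 t s a
  have h : ∑ s', q s' * m.smoothedValue σ θ s' ≤ lse σ (m.smoothedValue σ θ) := by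
    calc _ ≤ ∑ s', q s' * lse σ (m.smoothedValue σ θ) :=
          Finset.sum_le_sum fun s' _ => mul_le_mul_of_nonneg_left (le_lse hσ _ s') (hq.1 s')
      _ = _ := by rw [← Finset.sum_mul, hq.2, one_mul]
  have h' := mul_le_mul_of_nonneg_left h (mul_nonneg m.γ_nonneg m.R_nonneg)
  rw [he, m.sum_uncertainty_mul]
  unfold smoothedQ lookahead
  linarith

theorem sum_stageCost_le {σ : ℝ} (hσ : 0 < σ) (κ : m.Nature) (θ : Policy S A) (s₀ : S) (n : ℕ) :
    ∑ t ∈ Finset.range n, m.γ ^ t * m.stageCost κ.1 θ s₀ t ≤ m.smoothedValue σ θ s₀ := by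
  -- The induction needs the terminal term, which is dropped afterwards because it is nonnegative.
  have h : ∑ t ∈ Finset.range n, m.γ ^ t * m.stageCost κ.1 θ s₀ t +
      m.γ ^ n * ∑ s, stateDist κ.1 θ s₀ n s * m.smoothedValue σ θ s ≤
      m.smoothedValue σ θ s₀ := by
    induction n with
    | zero => simp [stateDist, Pi.single_apply]
    | succ n ih =>
      have h1 := mul_le_mul_of_nonneg_left (m.stageCost_add_le hσ κ θ s₀ n)
        (pow_nonneg m.γ_nonneg n)
      rw [Finset.sum_range_succ, pow_succ]
      linarith
  have h0 : 0 ≤ m.γ ^ n * ∑ s, stateDist κ.1 θ s₀ n s * m.smoothedValue σ θ s :=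
    mul_nonneg (pow_nonneg m.γ_nonneg n) (Finset.sum_nonneg fun s _ =>
      mul_nonneg (m.stateDist_nonneg κ θ s₀ n s) (m.smoothedValue_nonneg hσ θ s))
  linarith

theorem discountedCost_nonneg (κ : m.Nature) (θ : Policy S A) (s₀ : S) :
    0 ≤ m.discountedCost κ.1 θ s₀ :=
  tsum_nonneg fun t => mul_nonneg (pow_nonneg m.γ_nonneg t) (m.stageCost_nonneg κ θ s₀ t)

theorem discountedCost_le {σ : ℝ} (hσ : 0 < σ) (κ : m.Nature) (θ : Policy S A) (s₀ : S) :
    m.discountedCost κ.1 θ s₀ ≤ m.smoothedValue σ θ s₀ :=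
  Real.tsum_le_of_sum_range_le
    (fun t => mul_nonneg (pow_nonneg m.γ_nonneg t) (m.stageCost_nonneg κ θ s₀ t))
    (m.sum_stageCost_le hσ κ θ s₀)

/-- The stationary kernel which moves the contaminating mass to the state `i`. -/
noncomputable def natureTo (i : S) : m.Nature :=
  ⟨fun _ s a s' => (1 - m.R) * m.p s a s' + m.R * (Pi.single i 1 : S → ℝ) s',
    fun _ _ _ => ⟨Pi.single i 1, single_mem_stdSimplex ℝ i, rfl⟩⟩

instance : Nonempty m.Nature := ⟨m.natureTo (Classical.arbitrary S)⟩

/-- Any smoothed value bounds the family of costs, so the supremum is genuine and not the default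
value 0 of an unbounded one. -/
theorem le_robustValue {σ : ℝ} (hσ : 0 < σ) (θ : Policy S A) (s : S) (κ : m.Nature) :
    m.discountedCost κ.1 θ s ≤ m.robustValue θ s :=
  le_ciSup (f := fun κ : m.Nature => m.discountedCost κ.1 θ s)
    ⟨m.smoothedValue σ θ s, by rintro _ ⟨κ, rfl⟩; exact m.discountedCost_le hσ κ θ s⟩ κ

theorem robustValue_nonneg (θ : Policy S A) (s : S) : 0 ≤ m.robustValue θ s :=
  (m.discountedCost_nonneg (m.natureTo s) θ s).trans (m.le_robustValue one_pos θ s _)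

theorem robustValue_le {σ : ℝ} (hσ : 0 < σ) (θ : Policy S A) (s : S) :
    m.robustValue θ s ≤ m.smoothedValue σ θ s :=
  ciSup_le fun κ => m.discountedCost_le hσ κ θ s

/-- Nature moves the contaminating mass to a maximizer of the smoothed value. It then falls short of
log-sum-exp by at most log|S|/σ, so each step loses at most γR log|S|/σ, and the discounted losses
sum to the stated error. -/
theorem smoothedValue_le_robustValue_add {σ : ℝ} (hσ : 0 < σ) (θ : Policy S A) (s₀ : S) :
    m.smoothedValue σ θ s₀ ≤ m.robustValue θ s₀ +
      m.γ * m.R / (1 - m.γ) * (Real.log (Fintype.card S) / σ) := by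
  set V := m.smoothedValue σ θ with hV
  set l := Real.log (Fintype.card S) / σ with hl
  obtain ⟨i, hi⟩ := Finite.exists_max V
  set κ := m.natureTo i with hκ
  have hlse : lse σ V ≤ V i + l := lse_le_add_log hσ hi
  have hstep : ∀ t, ∑ s, stateDist κ.1 θ s₀ t s * V s ≤ m.stageCost κ.1 θ s₀ t +
      m.γ * ∑ s, stateDist κ.1 θ s₀ (t + 1) s * V s + m.γ * m.R * l := by
    intro t
    have hc : m.γ * m.R * l = ∑ s, stateDist κ.1 θ s₀ t s * (m.γ * m.R * l) := by
      rw [← Finset.sum_mul, m.sum_stateDist, one_mul]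
    rw [stageCost_add, hc, ← Finset.sum_add_distrib]
    refine Finset.sum_le_sum fun s _ => ?_
    rw [← mul_add]
    refine mul_le_mul_of_nonneg_left ?_ (m.stateDist_nonneg κ θ s₀ t s)
    have hc' : m.γ * m.R * l = θ.avg (fun _ _ => m.γ * m.R * l) s := by
      rw [Policy.avg, ← Finset.sum_mul, θ.sum_eq_one, one_mul]
    rw [hc']
    have hV' : V s = θ.avg (m.smoothedQ σ θ) s := by rw [m.avg_smoothedQ hσ]
    rw [hV']
    unfold Policy.avg
    rw [← Finset.sum_add_distrib]
    refine Finset.sum_le_sum fun a _ => ?_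
    rw [← mul_add]
    refine mul_le_mul_of_nonneg_left ?_ (θ.nonneg s a)
    have he : ∑ s', κ.1 t s a s' * V s' = _ := m.sum_uncertainty_mul (q := Pi.single i 1) V
    have hs : ∑ s', (Pi.single i 1 : S → ℝ) s' * V s' = V i := by simp [Pi.single_apply]
    rw [hs] at he
    beta_reduce
    have h' := mul_le_mul_of_nonneg_left hlse (mul_nonneg m.γ_nonneg m.R_nonneg)
    unfold smoothedQ lookahead
    rw [← hV]
    have he' := congrArg (m.γ * ·) he
    beta_reduce at he'
    linarith
  have hsum : ∀ n, V s₀ ≤ ∑ t ∈ Finset.range n, m.γ ^ t * m.stageCost κ.1 θ s₀ t +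
      m.γ ^ n * ∑ s, stateDist κ.1 θ s₀ n s * V s +
      (∑ t ∈ Finset.range n, m.γ ^ t) * (m.γ * m.R * l) := by
    intro n
    induction n with
    | zero => simp [stateDist, Pi.single_apply]
    | succ n ih =>
      have h1 := mul_le_mul_of_nonneg_left (hstep n) (pow_nonneg m.γ_nonneg n)
      rw [Finset.sum_range_succ, Finset.sum_range_succ, pow_succ]
      linarith
  have hnn : ∀ t, 0 ≤ m.γ ^ t * m.stageCost κ.1 θ s₀ t := fun t =>
    mul_nonneg (pow_nonneg m.γ_nonneg t) (m.stageCost_nonneg κ θ s₀ t)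
  have hsm : Summable fun t => m.γ ^ t * m.stageCost κ.1 θ s₀ t :=
    summable_of_sum_range_le hnn (m.sum_stageCost_le hσ κ θ s₀)
  have hl0 : 0 ≤ m.γ * m.R * l :=
    mul_nonneg (mul_nonneg m.γ_nonneg m.R_nonneg) (log_card_div_nonneg hσ)
  -- After n steps the terminal term is at most γⁿC_σ and vanishes in the limit.
  have hbound : ∀ n : ℕ, V s₀ ≤ m.robustValue θ s₀ + m.γ ^ n * m.Cσ σ +
      m.γ * m.R / (1 - m.γ) * l := by
    intro n
    have h1 : ∑ t ∈ Finset.range n, m.γ ^ t * m.stageCost κ.1 θ s₀ t ≤ m.robustValue θ s₀ :=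
      (hsm.sum_le_tsum _ fun t _ => hnn t).trans (m.le_robustValue hσ θ s₀ κ)
    have h2 : ∑ s, stateDist κ.1 θ s₀ n s * V s ≤ m.Cσ σ := by
      calc _ ≤ ∑ s, stateDist κ.1 θ s₀ n s * m.Cσ σ := Finset.sum_le_sum fun s _ =>
            mul_le_mul_of_nonneg_left (m.smoothedValue_le hσ θ s) (m.stateDist_nonneg κ θ s₀ n s)
        _ = _ := by rw [← Finset.sum_mul, m.sum_stateDist, one_mul]
    have h3 : ∑ t ∈ Finset.range n, m.γ ^ t ≤ (1 - m.γ)⁻¹ := by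
      rw [← tsum_geometric_of_lt_one m.γ_nonneg m.γ_lt_one]
      exact (summable_geometric_of_lt_one m.γ_nonneg m.γ_lt_one).sum_le_tsum _
        fun t _ => pow_nonneg m.γ_nonneg t
    have h2' := mul_le_mul_of_nonneg_left h2 (pow_nonneg m.γ_nonneg n)
    have h3' := mul_le_mul_of_nonneg_right h3 hl0
    have h4 : (1 - m.γ)⁻¹ * (m.γ * m.R * l) = m.γ * m.R / (1 - m.γ) * l := by ring
    have h5 := hsum n
    linarith
  have hlim := ((tendsto_pow_atTop_nhds_zero_of_lt_one m.γ_nonneg m.γ_lt_one).mul_const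
    (m.Cσ σ)).const_add (m.robustValue θ s₀) |>.add_const (m.γ * m.R / (1 - m.γ) * l)
  rw [zero_mul, add_zero] at hlim
  exact ge_of_tendsto' hlim hbound

theorem J_nonneg (θ : Policy S A) : 0 ≤ m.J θ :=
  Finset.sum_nonneg fun s _ => mul_nonneg ENNReal.toReal_nonneg (m.robustValue_nonneg θ s)

theorem J_le_smoothedJ {σ : ℝ} (hσ : 0 < σ) (θ : Policy S A) : m.J θ ≤ m.smoothedJ σ θ :=
  Finset.sum_le_sum fun s _ =>
    mul_le_mul_of_nonneg_left (m.robustValue_le hσ θ s) ENNReal.toReal_nonneg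

theorem smoothedJ_le_J_add {σ : ℝ} (hσ : 0 < σ) (θ : Policy S A) :
    m.smoothedJ σ θ ≤ m.J θ + m.γ * m.R / (1 - m.γ) * (Real.log (Fintype.card S) / σ) := by
  set x := m.γ * m.R / (1 - m.γ) * (Real.log (Fintype.card S) / σ)
  have hx : x = ∑ s, (m.ρ s).toReal * x := by
    rw [← Finset.sum_mul, sum_toReal_pmf, one_mul]
  rw [hx]
  unfold J smoothedJ
  rw [← Finset.sum_add_distrib]
  refine Finset.sum_le_sum fun s _ => ?_
  rw [← mul_add]
  exact mul_le_mul_of_nonneg_left (m.smoothedValue_le_robustValue_add hσ θ s)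
    ENNReal.toReal_nonneg

theorem smoothedJ_le_Cσ {σ : ℝ} (hσ : 0 < σ) (θ : Policy S A) : m.smoothedJ σ θ ≤ m.Cσ σ := by
  calc _ ≤ ∑ s, (m.ρ s).toReal * m.Cσ σ := Finset.sum_le_sum fun s _ =>
        mul_le_mul_of_nonneg_left (m.smoothedValue_le hσ θ s) ENNReal.toReal_nonneg
    _ = _ := by rw [← Finset.sum_mul, sum_toReal_pmf, one_mul]

theorem smoothedJ_nonneg {σ : ℝ} (hσ : 0 < σ) (θ : Policy S A) : 0 ≤ m.smoothedJ σ θ :=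
  (m.J_nonneg θ).trans (m.J_le_smoothedJ hσ θ)

theorem Jstar_nonneg : 0 ≤ m.Jstar := Real.iInf_nonneg m.J_nonneg

theorem J_sub_Jstar_le [Nonempty A] {θ : Policy S A} {x : ℝ} (h : ∀ θ', m.J θ - m.J θ' ≤ x) :
    m.J θ - m.Jstar ≤ x := by
  have : Nonempty (Policy S A) := policySet_nonempty.to_subtype
  have : m.J θ - x ≤ m.Jstar := le_ciInf fun θ' => by linarith [h θ']
  linarith

end RobustMDP

/-! ### Diameter of the policy set and projection onto it. -/

theorem euclideanSpace_norm_le_sum_abs {ι : Type*} [Fintype ι] (x : EuclideanSpace ℝ ι) :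
    ‖x‖ ≤ ∑ i, |x i| := by
  rw [EuclideanSpace.norm_eq]
  refine Real.sqrt_le_iff.2 ⟨Finset.sum_nonneg fun i _ => abs_nonneg _, ?_⟩
  simp only [Real.norm_eq_abs]
  exact Finset.sum_sq_le_sq_sum_of_nonneg fun i _ => abs_nonneg _

section

variable {S A : Type*} [Fintype S] [Fintype A]

theorem norm_policy_sub_le (θ θ' : Policy S A) :
    ‖θ.1 - θ'.1‖ ≤ Fintype.card S * Fintype.card A := by
  calc _ ≤ ∑ i : S × A, |(θ.1 - θ'.1) i| := euclideanSpace_norm_le_sum_abs _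
    _ ≤ ∑ _i : S × A, (1 : ℝ) := Finset.sum_le_sum fun i _ => by
        obtain ⟨s, a⟩ := i
        rw [PiLp.sub_apply]
        have := θ.nonneg s a
        have := θ.le_one s a
        have := θ'.nonneg s a
        have := θ'.le_one s a
        exact abs_le.2 ⟨by linarith, by linarith⟩
    _ = _ := by simp

theorem inner_sub_proj_le_zero [Nonempty A] (x : EuclideanSpace ℝ (S × A)) (θ : Policy S A) :
    inner ℝ (x - (proj x).1) (θ.1 - (proj x).1) ≤ 0 := by
  have : Nonempty (Policy S A) := ⟨θ⟩
  refine (norm_eq_iInf_iff_real_inner_le_zero convex_policySet (proj x).2).1 ?_ θ.1 θ.2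
  exact le_antisymm (le_ciInf (exists_projection x).choose_spec)
    (ciInf_le (f := fun w : Policy S A => ‖x - w.1‖)
      ⟨0, by rintro _ ⟨w, rfl⟩; exact norm_nonneg _⟩ (proj x))

end

/-! ### Bias and variance of the gradient estimate. -/

namespace RobustMDP

variable {S A : Type*} [Fintype S] [DecidableEq S] [Nonempty S] [Fintype A] [DecidableEq A]
variable (m : RobustMDP S A)

/-- The two end states share the stopping time and need not be independent. The gradient sample is a
sum of a function of each, so its mean sees only the marginals. -/
theorem map_fst_samplePair (σ : ℝ) (θ : Policy S A) (Q : QTable S A) :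
    (m.samplePair σ θ Q).map Prod.fst = m.stopped θ m.ρ := by
  have h : ∀ (μ : PMF S) (s : S), μ.map (fun _ => s) = PMF.pure s := fun μ s => PMF.map_const _ _
  simp [samplePair, stopped, PMF.map_bind, PMF.map_comp, Function.comp_def, h]

theorem map_snd_samplePair (σ : ℝ) (θ : Policy S A) (Q : QTable S A) :
    (m.samplePair σ θ Q).map Prod.snd = m.stopped θ (softmax σ (θ.avg Q)) := by
  have h : ∀ μ : PMF S, μ.map (fun s => s) = μ := fun μ => PMF.map_id _
  simp [samplePair, stopped, PMF.map_bind, PMF.map_comp, Function.comp_def, h]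

theorem gradTerm_apply (Q : QTable S A) (i s : S) (a : A) :
    m.gradTerm Q i (s, a) = 1 / m.δ * if i = s then Q s a else 0 := by
  unfold gradTerm gradPolicy
  by_cases h : i = s
  · subst h
    simp [Pi.single_apply]
  · simp [h, Ne.symm h]

theorem norm_gradTerm_le {Q : QTable S A} {q : ℝ} (hQ : ∀ s a, |Q s a| ≤ q) (s : S) :
    ‖m.gradTerm Q s‖ ≤ 1 / m.δ * (Fintype.card A * q) := by
  unfold gradTerm
  rw [norm_smul, Real.norm_of_nonneg (one_div_nonneg.2 m.δ_pos.le)]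
  refine mul_le_mul_of_nonneg_left ?_ (one_div_nonneg.2 m.δ_pos.le)
  calc _ ≤ ∑ a, ‖Q s a • gradPolicy s a‖ := norm_sum_le _ _
    _ ≤ ∑ _a : A, q := Finset.sum_le_sum fun a _ => by
        rw [norm_smul, gradPolicy]; simpa using hQ s a
    _ = _ := by simp

theorem norm_gradSample_le {Q : QTable S A} {q : ℝ} (hQ : ∀ s a, |Q s a| ≤ q) (z : S × S) :
    ‖m.gradSample Q z‖ ≤ Fintype.card A * q / (1 - m.γ) := by
  have h1 := m.norm_gradTerm_le hQ z.1
  have h2 := mul_le_mul_of_nonneg_left (m.norm_gradTerm_le hQ z.2) m.γR_div_nonneg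
  unfold gradSample
  refine (norm_add_le _ _).trans ?_
  rw [norm_smul, Real.norm_of_nonneg m.γR_div_nonneg]
  refine (add_le_add h1 h2).trans (le_of_eq ?_)
  rw [← mul_assoc (m.γ * m.R / (1 - m.γ)), ← add_mul, m.one_div_δ_add]
  ring

theorem norm_gradBatch_le {Q : QTable S A} {q : ℝ} (hQ : ∀ s a, |Q s a| ≤ q) {zs : List (S × S)}
    (hzs : 0 < zs.length) :
    ‖m.gradBatch Q zs‖ ≤ Fintype.card A * q / (1 - m.γ) := by
  have h : ∀ zs : List (S × S),
      ‖(zs.map (m.gradSample Q)).sum‖ ≤ zs.length * (Fintype.card A * q / (1 - m.γ)) := by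
    intro zs
    induction zs with
    | nil => simp
    | cons z zs ih =>
      simp only [List.map_cons, List.sum_cons, List.length_cons]
      refine (norm_add_le _ _).trans ?_
      have := m.norm_gradSample_le hQ z
      push_cast
      linarith
  have hl : (0 : ℝ) < zs.length := by exact_mod_cast hzs
  unfold gradBatch
  rw [norm_smul, Real.norm_of_nonneg (by positivity), one_div_mul_eq_div, div_le_iff₀ hl, mul_comm]
  exact h zs

/-- The expectation of the gradient estimate. -/
noncomputable def gradMean (σ : ℝ) (θ : Policy S A) (Q : QTable S A) : EuclideanSpace ℝ (S × A) :=
  ∑ z, (m.samplePair σ θ Q z).toReal • m.gradSample Q z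

theorem gradMean_apply (σ : ℝ) (θ : Policy S A) (Q : QTable S A) (s : S) (a : A) :
    m.gradMean σ θ Q (s, a) = m.visitation θ (softmax σ (θ.avg Q)) s * Q s a := by
  have hi : ∀ μ : PMF S, expect μ (fun i => if i = s then Q s a else 0) = (μ s).toReal * Q s a :=
    fun μ => by simp [expect_fintype]
  have h1 := hi (m.stopped θ m.ρ)
  have h2 := hi (m.stopped θ (softmax σ (θ.avg Q)))
  rw [← m.map_fst_samplePair σ θ Q, expect_map (bddOn_finite _ _), m.map_fst_samplePair] at h1
  rw [← m.map_snd_samplePair σ θ Q, expect_map (bddOn_finite _ _), m.map_snd_samplePair] at h2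
  have h : m.gradMean σ θ Q (s, a) = expect (m.samplePair σ θ Q) fun z =>
      1 / m.δ * (if z.1 = s then Q s a else 0) +
      m.γ * m.R / (1 - m.γ) * (1 / m.δ) * (if z.2 = s then Q s a else 0) := by
    rw [expect_fintype]
    simp only [gradMean, WithLp.ofLp_sum, Finset.sum_apply, PiLp.smul_apply, gradSample,
      PiLp.add_apply, gradTerm_apply, smul_eq_mul, mul_assoc]
  rw [h, expect_add (bddOn_finite _ _) (bddOn_finite _ _), expect_const_mul, expect_const_mul, h1,
    h2]
  unfold visitation occupancy
  ring

/-- Two sources of bias: the table error under the visitation weights, and the relative error 4σe of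
these weights times Q. Since the weights sum to 1/(1-γ), the sum over coordinates costs a factor |A|
but none of |S|. -/
theorem norm_gradMean_sub_le {σ e : ℝ} (hσ : 0 < σ) (θ : Policy S A) {Q : QTable S A}
    (hQ : ∀ s a, |Q s a - m.smoothedQ σ θ s a| ≤ e) (he : 2 * σ * e ≤ 1) (he0 : 0 ≤ e) :
    ‖m.gradMean σ θ Q - m.smoothedGrad σ θ‖ ≤
      Fintype.card A * (e + 4 * σ * e * m.Cσ σ) / (1 - m.γ) := by
  set V := m.smoothedValue σ θ with hV
  have havg : ∀ s, |θ.avg Q s - V s| ≤ e := by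
    intro s
    have hd : θ.avg Q s - V s = θ.avg (fun s a => Q s a - m.smoothedQ σ θ s a) s := by
      rw [hV, ← m.avg_smoothedQ hσ]
      simp only [Policy.avg, mul_sub, Finset.sum_sub_distrib]
    rw [hd]
    exact abs_le.2 ⟨le_avg θ fun a => (abs_le.1 (hQ s a)).1,
      avg_le θ fun a => (abs_le.1 (hQ s a)).2⟩
  have hsm := abs_softmax_sub_le hσ havg he
  set η := softmax σ V with hη
  set η' := softmax σ (θ.avg Q) with hη'
  set x := 4 * σ * e with hx
  have hx0 : 0 ≤ x := by positivity
  have hocc : ∀ s, |m.occupancy θ η' s - m.occupancy θ η s| ≤ x * m.occupancy θ η s := by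
    intro s
    have h1 := m.mul_occupancy_le θ (μ := η') (ν := η) (x := 1) (y := 1 + x) (fun i => by
      have := (abs_le.1 (hsm i)).2; linarith) s
    have h2 := m.mul_occupancy_le θ (μ := η) (ν := η') (x := 1 - x) (y := 1) (fun i => by
      have := (abs_le.1 (hsm i)).1; linarith) s
    exact abs_le.2 ⟨by linarith, by linarith⟩
  have hw : ∀ s, |m.visitation θ η' s - m.visitation θ η s| ≤ x * m.visitation θ η s := by
    intro s
    have h1 : m.visitation θ η' s - m.visitation θ η s =
        m.γ * m.R / (1 - m.γ) * (m.occupancy θ η' s - m.occupancy θ η s) := by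
      unfold visitation; ring
    have h2 := mul_le_mul_of_nonneg_left (hocc s) m.γR_div_nonneg
    have h3 := mul_nonneg hx0 (m.occupancy_nonneg θ m.ρ s)
    rw [h1, abs_mul, abs_of_nonneg m.γR_div_nonneg]
    unfold visitation
    linarith
  have hcoord : ∀ s a, |(m.gradMean σ θ Q - m.smoothedGrad σ θ) (s, a)| ≤
      m.visitation θ η' s * e + m.visitation θ η s * (x * m.Cσ σ) := by
    intro s a
    have h1 : (m.gradMean σ θ Q - m.smoothedGrad σ θ) (s, a) =
        m.visitation θ η' s * (Q s a - m.smoothedQ σ θ s a) +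
        (m.visitation θ η' s - m.visitation θ η s) * m.smoothedQ σ θ s a := by
      rw [PiLp.sub_apply, gradMean_apply]
      simp only [smoothedGrad]
      ring
    rw [h1]
    refine (abs_add_le _ _).trans (add_le_add ?_ ?_)
    · rw [abs_mul, abs_of_nonneg (m.visitation_nonneg θ η' s)]
      exact mul_le_mul_of_nonneg_left (hQ s a) (m.visitation_nonneg θ η' s)
    · rw [abs_mul, abs_of_nonneg (m.smoothedQ_nonneg hσ θ s a)]
      refine (mul_le_mul (hw s) (m.smoothedQ_le hσ θ s a) (m.smoothedQ_nonneg hσ θ s a)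
        (mul_nonneg hx0 (m.visitation_nonneg θ η s))).trans (le_of_eq ?_)
      ring
  calc _ ≤ ∑ i : S × A, |(m.gradMean σ θ Q - m.smoothedGrad σ θ) i| :=
        euclideanSpace_norm_le_sum_abs _
    _ ≤ ∑ i : S × A, (m.visitation θ η' i.1 * e + m.visitation θ η i.1 * (x * m.Cσ σ)) :=
        Finset.sum_le_sum fun i _ => hcoord i.1 i.2
    _ = _ := by
        rw [Fintype.sum_prod_type]
        simp only [Finset.sum_const, Finset.card_univ, nsmul_eq_mul]
        rw [← Finset.mul_sum, Finset.sum_add_distrib, ← Finset.sum_mul, ← Finset.sum_mul,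
          m.sum_visitation, m.sum_visitation]
        ring

theorem expect_norm_gradBatch_sub_sq_le {σ q : ℝ} (θ : Policy S A) {Q : QTable S A}
    (hQ : ∀ s a, |Q s a| ≤ q) {M : ℕ} (hM : 0 < M) :
    expect (iidList (m.samplePair σ θ Q) M)
      (fun zs => ‖m.gradBatch Q zs - m.gradMean σ θ Q‖ ^ 2) ≤
      4 * (Fintype.card A * q / (1 - m.γ)) ^ 2 / M := by
  set μ := m.samplePair σ θ Q with hμ
  set G := Fintype.card A * q / (1 - m.γ) with hG
  set v := m.gradMean σ θ Q with hv
  have hM' : (0 : ℝ) < M := by exact_mod_cast hM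
  have hX : ∑ z, (μ z).toReal • (m.gradSample Q z - v) = 0 := by
    simp only [smul_sub, Finset.sum_sub_distrib, ← Finset.sum_smul, sum_toReal_pmf, one_smul]
    exact sub_self _
  have hvar := expect_iidList_norm_sq_sum μ (fun z => m.gradSample Q z - v) hX M
  have hvG : ‖v‖ ≤ G := by
    calc ‖v‖ ≤ ∑ z, ‖(μ z).toReal • m.gradSample Q z‖ := norm_sum_le _ _
      _ ≤ ∑ z, (μ z).toReal * G := Finset.sum_le_sum fun z _ => by
          rw [norm_smul, Real.norm_of_nonneg ENNReal.toReal_nonneg]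
          exact mul_le_mul_of_nonneg_left (m.norm_gradSample_le hQ z) ENNReal.toReal_nonneg
      _ = G := by rw [← Finset.sum_mul, sum_toReal_pmf, one_mul]
  have hone : expect μ (fun z => ‖m.gradSample Q z - v‖ ^ 2) ≤ 4 * G ^ 2 := by
    rw [← expect_const μ (4 * G ^ 2)]
    refine expect_mono (bddOn_finite _ _) (bddOn_const _ _) fun z _ => ?_
    have h1 : ‖m.gradSample Q z - v‖ ≤ 2 * G := by
      have := norm_sub_le (m.gradSample Q z) v
      have := m.norm_gradSample_le hQ z
      linarith
    have := pow_le_pow_left₀ (norm_nonneg _) h1 2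
    linarith
  -- `gradBatch` divides by the length of the list, which equals M on the support only.
  have hbatch : ∀ zs ∈ (iidList μ M).support, ‖m.gradBatch Q zs - v‖ ^ 2 ≤
      1 / (M : ℝ) ^ 2 * ‖(zs.map fun z => m.gradSample Q z - v).sum‖ ^ 2 := by
    intro zs hzs
    have hl := length_of_mem_support_iidList μ M zs hzs
    have hs : ∀ zs : List (S × S), (zs.map fun z => m.gradSample Q z - v).sum =
        (zs.map (m.gradSample Q)).sum - (zs.length : ℝ) • v := by
      intro zs
      induction zs with
      | nil => simp
      | cons z zs ih =>
        simp only [List.map_cons, List.sum_cons, List.length_cons, ih]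
        push_cast
        rw [add_smul, one_smul]
        abel
    have he : m.gradBatch Q zs - v =
        (1 / (M : ℝ)) • (zs.map fun z => m.gradSample Q z - v).sum := by
      rw [hs, gradBatch, hl, smul_sub, smul_smul, one_div_mul_cancel hM'.ne', one_smul]
    rw [he, norm_smul, Real.norm_of_nonneg (by positivity), mul_pow, one_div_pow]
  refine (expect_mono (bddOn_iidList _ _ _) (bddOn_iidList _ _ _) hbatch).trans ?_
  rw [expect_const_mul, hvar]
  calc _ ≤ 1 / (M : ℝ) ^ 2 * (M * (4 * G ^ 2)) := by gcongr
    _ = _ := by field_simp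

theorem expect_norm_gradBatch_sub_smoothedGrad_sq_le {σ q b : ℝ} (θ : Policy S A)
    {Q : QTable S A} (hQ : ∀ s a, |Q s a| ≤ q)
    (hb : ‖m.gradMean σ θ Q - m.smoothedGrad σ θ‖ ≤ b) {M : ℕ} (hM : 0 < M) :
    expect (iidList (m.samplePair σ θ Q) M)
      (fun zs => ‖m.gradBatch Q zs - m.smoothedGrad σ θ‖ ^ 2) ≤
      8 * (Fintype.card A * q / (1 - m.γ)) ^ 2 / M + 2 * b ^ 2 := by
  have h1 := m.expect_norm_gradBatch_sub_sq_le (σ := σ) θ hQ hM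
  have h2 : expect (iidList (m.samplePair σ θ Q) M)
      (fun zs => ‖m.gradBatch Q zs - m.smoothedGrad σ θ‖ ^ 2) ≤
      expect (iidList (m.samplePair σ θ Q) M) fun zs =>
        2 * ‖m.gradBatch Q zs - m.gradMean σ θ Q‖ ^ 2 + 2 * b ^ 2 := by
    refine expect_mono (bddOn_iidList _ _ _) (bddOn_iidList _ _ _) fun zs _ => ?_
    have h3 := norm_add_le (m.gradBatch Q zs - m.gradMean σ θ Q)
      (m.gradMean σ θ Q - m.smoothedGrad σ θ)
    rw [sub_add_sub_cancel] at h3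
    have h4 := pow_le_pow_left₀ (norm_nonneg _) (h3.trans (add_le_add_right hb _)) 2
    nlinarith [sq_nonneg (‖m.gradBatch Q zs - m.gradMean σ θ Q‖ - b)]
  rw [expect_add (bddOn_iidList _ _ _) (bddOn_const _ _), expect_const_mul, expect_const] at h2
  refine h2.trans ?_
  rw [show 8 * (Fintype.card A * q / (1 - m.γ)) ^ 2 / (M : ℝ) =
    2 * (4 * (Fintype.card A * q / (1 - m.γ)) ^ 2 / M) by ring]
  linarith

/-! ### One projected step. -/

/-- The first-order optimality gap after one projected step, and the decrease of the smoothed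
objective. -/
theorem J_sub_Jstar_le_of_step [Nonempty A] {σ ε r G : ℝ} (hσ : 0 < σ) (hε : 0 < ε) (hr : 0 < r)
    (hρ : ∀ s, r ≤ (m.ρ s).toReal) (θ : Policy S A) (g : EuclideanSpace ℝ (S × A))
    (hg : ‖g‖ ≤ G) {C D : ℝ} (hC : C = 1 / ((1 - m.γ) * r))
    (hD : D = Fintype.card S * Fintype.card A) :
    m.J θ - m.Jstar ≤ m.γ * m.R / (1 - m.γ) * (Real.log (Fintype.card S) / σ) + 2 * ε +
      (C * (G + 2 * D)) ^ 2 * m.Lσ σ / (4 * ε) *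
        (m.smoothedJ σ θ - m.smoothedJ σ (proj (θ.1 - (1 / (2 * m.Lσ σ)) • g))) +
      ((C * D) ^ 2 / 4 + (C * (G + 2 * D)) ^ 2 / 8) / ε * ‖g - m.smoothedGrad σ θ‖ ^ 2 := by
  set L := m.Lσ σ with hL
  set θ' := proj (θ.1 - (1 / (2 * L)) • g) with hθ'
  set d := θ'.1 - θ.1 with hd
  set v := m.smoothedGrad σ θ with hv
  set e := g - v with he
  have hL1 : 1 ≤ L := m.one_le_Lσ hσ
  have hL0 : 0 < L := by linarith
  have hγ := m.one_sub_γ_pos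
  have hC0 : 0 < C := by rw [hC]; positivity
  have hD0 : 0 ≤ D := by rw [hD]; positivity
  have hG0 : 0 ≤ G := (norm_nonneg g).trans hg
  -- The variational inequality of the projection, scaled by 2L, the inverse step size.
  have hproj : ∀ θ'' : Policy S A, inner ℝ g (θ'.1 - θ''.1) ≤ 2 * L * inner ℝ d (θ''.1 - θ'.1) := by
    intro θ''
    have h := inner_sub_proj_le_zero (θ.1 - (1 / (2 * L)) • g) θ''
    rw [← hθ'] at h
    have h1 : θ.1 - (1 / (2 * L)) • g - θ'.1 = -d - (1 / (2 * L)) • g := by rw [hd]; abel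
    have h2 : θ'.1 - θ''.1 = -(θ''.1 - θ'.1) := by abel
    rw [h1, inner_sub_left, inner_neg_left, real_inner_smul_left] at h
    rw [h2, inner_neg_right]
    have h3 : 2 * L * (-inner ℝ d (θ''.1 - θ'.1) - 1 / (2 * L) * inner ℝ g (θ''.1 - θ'.1)) =
        - (2 * L * inner ℝ d (θ''.1 - θ'.1)) - inner ℝ g (θ''.1 - θ'.1) := by
      field_simp
    have h4 := mul_nonpos_of_nonneg_of_nonpos (by positivity : 0 ≤ 2 * L) h
    linarith
  -- The coefficient of ‖d‖² is -2L from the projection, L/2 from smoothness and L/2 from Young's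
  -- inequality on ⟨e, d⟩, in all -L.
  have hdec : L * ‖d‖ ^ 2 ≤ m.smoothedJ σ θ - m.smoothedJ σ θ' + ‖e‖ ^ 2 / (2 * L) := by
    have h1 := m.smoothedJ_le_add hσ θ θ'
    have h2 := hproj θ
    have h3 : θ.1 - θ'.1 = -d := by rw [hd]; abel
    rw [h3, inner_neg_right, real_inner_self_eq_norm_sq, ← hd] at h2
    rw [← hd, ← hv, ← hL] at h1
    have h4 : inner ℝ v d = inner ℝ g d - inner ℝ e d := by rw [← inner_sub_left, he]; simp
    have h5 := abs_le.1 (abs_real_inner_le_norm e d)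
    have h6 : ‖e‖ * ‖d‖ ≤ L / 2 * ‖d‖ ^ 2 + ‖e‖ ^ 2 / (2 * L) := by
      have : L / 2 * ‖d‖ ^ 2 + ‖e‖ ^ 2 / (2 * L) - ‖e‖ * ‖d‖ = (L * ‖d‖ - ‖e‖) ^ 2 / (2 * L) := by
        field_simp; ring
      have h7 : 0 ≤ (L * ‖d‖ - ‖e‖) ^ 2 / (2 * L) := by positivity
      linarith
    linarith [h5.1]
  -- The gap is taken at `θ`, by splitting θ - θ'' at θ'. The bound L ≥ 1 merges G‖d‖ with 2LD‖d‖
  -- into a multiple of L‖d‖.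
  have hgap : ∀ θ'' : Policy S A, inner ℝ v (θ.1 - θ''.1) ≤
      (G + 2 * D) * (L * ‖d‖) + D * ‖e‖ := by
    intro θ''
    have h1 := hproj θ''
    have h2 : inner ℝ v (θ.1 - θ''.1) =
        -inner ℝ g d + inner ℝ g (θ'.1 - θ''.1) - inner ℝ e (θ.1 - θ''.1) := by
      rw [← inner_neg_right, ← inner_add_right, he, inner_sub_left]
      have : -d + (θ'.1 - θ''.1) = θ.1 - θ''.1 := by rw [hd]; abel
      rw [this]; ring
    have h3 := (abs_le.1 (abs_real_inner_le_norm g d)).1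
    have h4 := (abs_le.1 (abs_real_inner_le_norm e (θ.1 - θ''.1))).1
    have h5 := (abs_le.1 (abs_real_inner_le_norm d (θ''.1 - θ'.1))).2
    have h6 : ‖e‖ * ‖θ.1 - θ''.1‖ ≤ D * ‖e‖ := by
      rw [mul_comm, hD]
      exact mul_le_mul_of_nonneg_right (norm_policy_sub_le _ _) (norm_nonneg _)
    have h7 : ‖d‖ * ‖θ''.1 - θ'.1‖ ≤ D * ‖d‖ := by
      rw [mul_comm, hD]
      exact mul_le_mul_of_nonneg_right (norm_policy_sub_le _ _) (norm_nonneg _)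
    have h8 : ‖g‖ * ‖d‖ ≤ G * (L * ‖d‖) := mul_le_mul hg
      (le_mul_of_one_le_left (norm_nonneg _) hL1) (norm_nonneg _) hG0
    have h9 := mul_le_mul_of_nonneg_left (h5.trans h7) (by positivity : 0 ≤ 2 * L)
    linarith
  have hdom : m.J θ - m.Jstar ≤ m.γ * m.R / (1 - m.γ) * (Real.log (Fintype.card S) / σ) +
      C * ((G + 2 * D) * (L * ‖d‖) + D * ‖e‖) := m.J_sub_Jstar_le fun θ'' => by
    have h1 := m.smoothedJ_sub_le hσ θ θ'' hr hρ hgap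
    have h2 := m.J_le_smoothedJ hσ θ
    have h3 := m.smoothedJ_le_J_add hσ θ''
    rw [← hC] at h1
    linarith
  -- The domination bound is linear in L‖d‖ and ‖e‖, whereas only squares are controlled; each
  -- conversion costs one ε, whence the 2ε.
  have amgm : ∀ x y : ℝ, x * y ≤ ε + x ^ 2 / (4 * ε) * y ^ 2 := fun x y => by
    have : ε + x ^ 2 / (4 * ε) * y ^ 2 - x * y = (2 * ε - x * y) ^ 2 / (4 * ε) := by
      field_simp; ring
    have h7 : 0 ≤ (2 * ε - x * y) ^ 2 / (4 * ε) := by positivity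
    linarith
  have k1 := amgm (C * (G + 2 * D)) (L * ‖d‖)
  have k2 := amgm (C * D) ‖e‖
  have k3 := mul_le_mul_of_nonneg_left hdec
    (by positivity : 0 ≤ (C * (G + 2 * D)) ^ 2 * L / (4 * ε))
  have k4 : (C * (G + 2 * D)) ^ 2 * L / (4 * ε) * (L * ‖d‖ ^ 2) =
      (C * (G + 2 * D)) ^ 2 / (4 * ε) * (L * ‖d‖) ^ 2 := by ring
  have k5 : (C * (G + 2 * D)) ^ 2 * L / (4 * ε) *
      (m.smoothedJ σ θ - m.smoothedJ σ θ' + ‖e‖ ^ 2 / (2 * L)) =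
      (C * (G + 2 * D)) ^ 2 * L / (4 * ε) * (m.smoothedJ σ θ - m.smoothedJ σ θ') +
      (C * (G + 2 * D)) ^ 2 / 8 / ε * ‖e‖ ^ 2 := by
    field_simp; ring
  have k6 : ((C * D) ^ 2 / 4 + (C * (G + 2 * D)) ^ 2 / 8) / ε * ‖e‖ ^ 2 =
      (C * D) ^ 2 / (4 * ε) * ‖e‖ ^ 2 + (C * (G + 2 * D)) ^ 2 / 8 / ε * ‖e‖ ^ 2 := by
    field_simp
  rw [k4, k5] at k3
  rw [k6]
  linarith

end RobustMDP

/-! ### Telescoping, and the constants as functions of ε. -/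

theorem exists_le_of_le_add_mul_sub {j a : ℕ → ℝ} {T : ℕ} {x w b ε : ℝ} (hT : 0 < T)
    (hw : 0 ≤ w) (h : ∀ t < T, j t ≤ x + w * (a t - a (t + 1))) (h0 : a 0 ≤ b) (hend : 0 ≤ a T)
    (hb : w * b ≤ T * ε) : ∃ t < T, j t ≤ x + ε := by
  by_contra! hcon
  have hsum : ∑ t ∈ Finset.range T, (x + ε) < ∑ t ∈ Finset.range T, (x + w * (a t - a (t + 1))) :=
    Finset.sum_lt_sum_of_nonempty (Finset.nonempty_range_iff.2 hT.ne') fun t ht =>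
      (hcon t (Finset.mem_range.1 ht)).trans_le (h t (Finset.mem_range.1 ht))
  simp only [Finset.sum_add_distrib, ← Finset.mul_sum, Finset.sum_range_sub', Finset.sum_const,
    Finset.card_range, nsmul_eq_mul] at hsum
  have := mul_le_mul_of_nonneg_left (show a 0 - a T ≤ b by linarith) hw
  linarith

namespace RobustMDP

section Constants

variable {S A : Type*} [Fintype S] [Fintype A] (m : RobustMDP S A)

/-- With σ = K/ε, the term log|S|/σ is linear in ε and σ itself occurs once, as a factor. So ε·L_σ
is a polynomial in ε, bounded on the compact interval [0, ε₀]. -/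
theorem exists_Lσ_le (K ε₀ : ℝ) :
    ∃ L, 0 < L ∧ ∀ ε, 0 < ε → ε ≤ ε₀ → m.Lσ (K / ε) ≤ L / ε := by
  let C : ℝ → ℝ := fun ε =>
    1 / (1 - m.γ) * (1 + 2 * m.γ * m.R * (Real.log (Fintype.card S) * ε / K))
  let CV : ℝ → ℝ := fun ε => 1 / (1 - m.γ) * Fintype.card A * C ε
  let k : ℝ → ℝ := fun ε => 1 / m.δ * (Fintype.card A * CV ε) +
    2 * (Fintype.card A : ℝ) ^ 2 * m.γ * (1 - m.R) / m.δ ^ 2 * C ε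
  let F : ℝ → ℝ := fun ε => ε * k ε + m.γ * m.R / (1 - m.γ) *
    (Real.sqrt (Fintype.card S) * (ε * k ε) +
      2 * K * Fintype.card S * CV ε * (1 / m.δ) * Fintype.card A * C ε)
  have hF : Continuous F := by unfold F k CV C; fun_prop
  obtain ⟨L, hL⟩ := (isCompact_Icc (a := (0 : ℝ)) (b := ε₀)).exists_bound_of_continuousOn
    hF.continuousOn
  refine ⟨|L| + 1, by positivity, fun ε hε hε₀ => ?_⟩
  rw [le_div_iff₀ hε]
  have h := (le_abs_self _).trans (hL ε ⟨hε.le, hε₀⟩)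
  have hC : m.Cσ (K / ε) = C ε := by
    unfold Cσ C; rw [div_div_eq_mul_div]
  have hCV : m.CVσ (K / ε) = CV ε := by unfold CVσ CV; rw [hC]
  have hk : m.kB (K / ε) = k ε := by unfold kB k; rw [hC, hCV]
  have hFL : m.Lσ (K / ε) * ε = F ε := by
    unfold Lσ F
    rw [hC, hCV, hk]
    field_simp
  rw [hFL]
  linarith [le_abs_self L]

theorem log_card_div_mul_le {K ε : ℝ} (hK : 0 < K)
    (hK' : 2 * m.γ * m.R * Real.log (Fintype.card S) / (1 - m.γ) ≤ K) (hε : 0 < ε) :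
    m.γ * m.R / (1 - m.γ) * (Real.log (Fintype.card S) / (K / ε)) ≤ ε / 2 := by
  have h : m.γ * m.R / (1 - m.γ) * (Real.log (Fintype.card S) / (K / ε)) =
      2 * m.γ * m.R * Real.log (Fintype.card S) / (1 - m.γ) * (ε / (2 * K)) := by
    have := m.one_sub_γ_pos.ne'
    field_simp
  rw [h]
  refine (mul_le_mul_of_nonneg_right hK' (by positivity)).trans (le_of_eq ?_)
  field_simp

theorem Cσ_le {K ε : ℝ} (hK : 0 < K)
    (hK' : 2 * m.γ * m.R * Real.log (Fintype.card S) / (1 - m.γ) ≤ K) (hε : 0 < ε) :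
    m.Cσ (K / ε) ≤ 1 / (1 - m.γ) + ε := by
  have h := m.log_card_div_mul_le hK hK' hε
  have h' : m.Cσ (K / ε) = 1 / (1 - m.γ) +
      2 * (m.γ * m.R / (1 - m.γ) * (Real.log (Fintype.card S) / (K / ε))) := by
    unfold Cσ; ring
  rw [h']
  linarith

end Constants

variable {S A : Type*} [Fintype S] [DecidableEq S] [Nonempty S] [Fintype A] [DecidableEq A]
variable (m : RobustMDP S A)

theorem exists_pos_le_ρ : ∃ r, 0 < r ∧ ∀ s, r ≤ (m.ρ s).toReal := by
  obtain ⟨s₀, hs₀⟩ := Finite.exists_min fun s => (m.ρ s).toReal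
  exact ⟨_, ENNReal.toReal_pos (m.ρ_pos s₀).ne' (m.ρ.apply_ne_top s₀), hs₀⟩

theorem bddOn_smoothedJ {σ : ℝ} (hσ : 0 < σ) {α : Type*} (μ : PMF α) (f : α → Policy S A) :
    BddOn μ fun x => m.smoothedJ σ (f x) :=
  ⟨m.Cσ σ, fun x _ => by
    rw [abs_of_nonneg (m.smoothedJ_nonneg hσ _)]; exact m.smoothedJ_le_Cσ hσ _⟩

theorem bddOn_J_sub_Jstar {α : Type*} (μ : PMF α) (f : α → Policy S A) :
    BddOn μ fun x => m.J (f x) - m.Jstar :=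
  ⟨m.Cσ 1 + m.Jstar, fun x _ => by
    have h1 := m.J_nonneg (f x)
    have h2 := (m.J_le_smoothedJ one_pos (f x)).trans (m.smoothedJ_le_Cσ one_pos (f x))
    have h3 := m.Jstar_nonneg
    have h4 := m.Cσ_pos one_pos
    exact abs_le.2 ⟨by linarith, by linarith⟩⟩

/-- The conditional expectation of the optimality gap, given the output of the critic. -/
theorem J_sub_Jstar_le_expect_step [Nonempty A] {σ ε r q β : ℝ} (hσ : 0 < σ) (hε : 0 < ε)
    (hr : 0 < r) (hρ : ∀ s, r ≤ (m.ρ s).toReal) (θ : Policy S A) {Q : QTable S A}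
    (hQ : ∀ s a, |Q s a| ≤ q) (hβ : ‖m.gradMean σ θ Q - m.smoothedGrad σ θ‖ ≤ β) {M : ℕ}
    (hM : 0 < M) {C D G B E : ℝ} (hC : C = 1 / ((1 - m.γ) * r))
    (hD : D = Fintype.card S * Fintype.card A) (hG : G = Fintype.card A * q / (1 - m.γ))
    (hB : B = C * (G + 2 * D)) (hE : E = (C * D) ^ 2 / 4 + B ^ 2 / 8)
    (hlog : m.γ * m.R / (1 - m.γ) * (Real.log (Fintype.card S) / σ) ≤ ε / 2)
    (herr : (8 * G ^ 2 / M + 2 * β ^ 2) * (E / ε) ≤ ε) :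
    m.J θ - m.Jstar ≤ 7 / 2 * ε + B ^ 2 * m.Lσ σ / (4 * ε) * (m.smoothedJ σ θ -
      expect (iidList (m.samplePair σ θ Q) M) fun zs =>
        m.smoothedJ σ (proj (θ.1 - (1 / (2 * m.Lσ σ)) • m.gradBatch Q zs))) := by
  set w := B ^ 2 * m.Lσ σ / (4 * ε) with hw
  have hE0 : 0 ≤ E := by rw [hE]; positivity
  have hexp := m.expect_norm_gradBatch_sub_smoothedGrad_sq_le θ hQ hβ hM
  rw [← hG] at hexp
  have hexp' := (mul_le_mul_of_nonneg_right hexp (by positivity : 0 ≤ E / ε)).trans herr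
  -- The 5/2 ε is ε/2 from smoothing and 2ε from Young's inequality; the averaged gradient error
  -- adds one more ε.
  have hpt := expect_mono (bddOn_const (iidList (m.samplePair σ θ Q) M)
    (m.J θ - m.Jstar)) (((bddOn_const _ (5 / 2 * ε + w * m.smoothedJ σ θ)).add
      ((bddOn_iidList _ _ fun zs => m.smoothedJ σ
        (proj (θ.1 - (1 / (2 * m.Lσ σ)) • m.gradBatch Q zs))).const_mul (-w))).add
      ((bddOn_iidList _ _ fun zs =>
        ‖m.gradBatch Q zs - m.smoothedGrad σ θ‖ ^ 2).const_mul (E / ε))) fun zs hzs => by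
    have hlen := length_of_mem_support_iidList _ M zs hzs
    have h1 := m.J_sub_Jstar_le_of_step hσ hε hr hρ θ (m.gradBatch Q zs)
      (m.norm_gradBatch_le hQ (by omega)) hC hD
    rw [← hG, ← hB, ← hE, ← hw] at h1
    linarith
  rw [expect_add ((bddOn_const _ _).add ((bddOn_iidList _ _ _).const_mul _))
    ((bddOn_iidList _ _ _).const_mul _), expect_add (bddOn_const _ _)
    ((bddOn_iidList _ _ _).const_mul _), expect_const, expect_const, expect_const_mul,
    expect_const_mul] at hpt
  linarith

/-- If every iteration satisfies `J - J^* ≤ x + w (J_σ - J_σ⁺)` in conditional expectation, then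
so do the expectations. -/
theorem expect_J_sub_Jstar_le [Nonempty A] {σ α x w : ℝ} (hσ : 0 < σ) {M t : ℕ}
    {θ₀ : Policy S A} {critic : History S A → PMF (QTable S A × S)}
    (hstep : ∀ h ∈ (m.law σ α M θ₀ critic t).support, ∀ q ∈ (critic h).support,
      m.J h.1 - m.Jstar ≤ x + w * (m.smoothedJ σ h.1 -
        expect (iidList (m.samplePair σ h.1 q.1) M) fun zs =>
          m.smoothedJ σ (proj (h.1.1 - α • m.gradBatch q.1 zs)))) :
    expect (m.law σ α M θ₀ critic t) (fun h => m.J h.1 - m.Jstar) ≤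
      x + w * (expect (m.law σ α M θ₀ critic t) (fun h => m.smoothedJ σ h.1) -
        expect (m.law σ α M θ₀ critic (t + 1)) fun h => m.smoothedJ σ h.1) := by
  set μ := m.law σ α M θ₀ critic t with hμ
  set k : History S A → PMF (History S A) := fun h => (critic h).bind fun q =>
    (iidList (m.samplePair σ h.1 q.1) M).map fun zs =>
      (proj (h.1.1 - α • m.gradBatch q.1 zs), (h.1, q, zs) :: h.2) with hk
  have hlaw : m.law σ α M θ₀ critic (t + 1) = μ.bind k := rfl
  have hb := m.bddOn_smoothedJ hσ (μ.bind k) Prod.fst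
  -- The step bound is averaged over the critic's output and the batch for a fixed history, then
  -- over histories.
  have hcond : ∀ h ∈ μ.support, m.J h.1 - m.Jstar ≤
      x + w * m.smoothedJ σ h.1 + -w * expect (k h) fun h => m.smoothedJ σ h.1 := by
    intro h hh
    have hbk := m.bddOn_smoothedJ hσ (k h) Prod.fst
    have hin : ∀ q : QTable S A × S, expect ((iidList (m.samplePair σ h.1 q.1) M).map fun zs =>
        ((proj (h.1.1 - α • m.gradBatch q.1 zs), (h.1, q, zs) :: h.2) : History S A))
        (fun h => m.smoothedJ σ h.1) =
        expect (iidList (m.samplePair σ h.1 q.1) M) fun zs =>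
          m.smoothedJ σ (proj (h.1.1 - α • m.gradBatch q.1 zs)) := fun q =>
      expect_map (m.bddOn_smoothedJ hσ _ Prod.fst)
    have hexp := expect_bind hbk
    have hbq := hbk.expect_bind
    simp only [hin] at hexp hbq
    have hmono := expect_mono (bddOn_const (critic h) (m.J h.1 - m.Jstar))
      ((bddOn_const (critic h) (x + w * m.smoothedJ σ h.1)).add (hbq.const_mul (-w)))
      fun q hq => by
        have := hstep h hh q hq
        linarith
    rw [expect_const, expect_add (bddOn_const _ _) (hbq.const_mul _), expect_const,
      expect_const_mul] at hmono
    rw [hexp]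
    exact hmono
  have hJs := m.bddOn_smoothedJ hσ μ Prod.fst
  have hmono := expect_mono (m.bddOn_J_sub_Jstar μ Prod.fst)
    (((bddOn_const μ x).add (hJs.const_mul w)).add (hb.expect_bind.const_mul (-w))) hcond
  rw [expect_add ((bddOn_const μ x).add (hJs.const_mul w)) (hb.expect_bind.const_mul (-w)),
    expect_add (bddOn_const μ x) (hJs.const_mul w), expect_const, expect_const_mul,
    expect_const_mul] at hmono
  rw [hlaw, expect_bind hb]
  linarith

end RobustMDP

end RobustAC

/-! ### Choice of the constants and conclusion. -/

theorem theorem7 {S A : Type*} [Fintype S] [DecidableEq S] [Nonempty S]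
    [Fintype A] [DecidableEq A] [Nonempty A] (m : RobustAC.RobustMDP S A)
    (K : ℝ) (hK : 0 < K)
    (hK' : 2 * m.γ * m.R * Real.log (Fintype.card S) / (1 - m.γ) ≤ K) :
    ∃ cEst cM cT : ℝ, 0 < cEst ∧ 0 < cM ∧ 0 < cT ∧
      ∀ ε : ℝ, 0 < ε → ∀ σ α : ℝ, σ = K / ε → α = 1 / (2 * m.Lσ σ) →
      ∀ εest : ℝ, εest ≤ cEst * ε ^ 2 →
      ∀ M T : ℕ, cM / ε ^ 2 ≤ (M : ℝ) → cT / ε ^ 3 ≤ (T : ℝ) →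
      ∀ (θ₀ : RobustAC.Policy S A)
        (critic : RobustAC.RobustMDP.History S A → PMF (RobustAC.QTable S A × S)),
      (∀ t < T, ∀ h ∈ (m.law σ α M θ₀ critic t).support,
        m.IsTDOutput σ h.1 (critic h) ∧
        ∀ q ∈ (critic h).support, ∀ s a, |q.1 s a - m.smoothedQ σ h.1 s a| ≤ εest) →
      ∃ t ≤ T,
        Summable (fun h => ((m.law σ α M θ₀ critic t) h).toReal * (m.J h.1 - m.Jstar)) ∧
        RobustAC.expect (m.law σ α M θ₀ critic t) (fun h => m.J h.1 - m.Jstar) ≤ 7 * ε := by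
  open RobustAC RobustAC.RobustMDP in
  have hγ := m.one_sub_γ_pos
  have hA := one_le_card_real A
  have hS := one_le_card_real S
  obtain ⟨r, hr, hρ⟩ := m.exists_pos_le_ρ
  -- Since 1/(1-γ) = 6ε₀, for ε ≥ ε₀ the initial gap is at most C_σ ≤ 1/(1-γ) + ε ≤ 7ε and t = 0
  -- suffices. Only this case needs the full factor 7.
  set ε₀ := 1 / (6 * (1 - m.γ)) with hε₀
  have hε₀0 : 0 < ε₀ := by positivity
  obtain ⟨L, hL0, hL⟩ := m.exists_Lσ_le K ε₀
  -- For ε < ε₀ one has C_σ ≤ 2/(1-γ), and the extra 1 covers the critic's error, so b bounds every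
  -- critic table.
  set b := 2 / (1 - m.γ) + 1 with hb
  have hb0 : 0 < b := by positivity
  set G := Fintype.card A * b / (1 - m.γ) with hG
  have hG0 : 0 < G := by positivity
  set C := 1 / ((1 - m.γ) * r) with hC
  set D : ℝ := Fintype.card S * Fintype.card A with hD
  have hC0 : 0 < C := by positivity
  have hD0 : 0 < D := by positivity
  set B := C * (G + 2 * D) with hB
  have hB0 : 0 < B := by positivity
  set E := (C * D) ^ 2 / 4 + B ^ 2 / 8 with hE
  have hE0 : 0 < E := by positivity
  set F := Fintype.card A * (ε₀ + 4 * K * b) / (1 - m.γ) with hF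
  have hF0 : 0 < F := by positivity
  -- Each summand secures one condition on c = 1/den: c ≤ 1, a small squared bias, 2σe ≤ 1 for the
  -- softmax comparison, and critic error e ≤ 1.
  set den := 1 + 4 * E * F ^ 2 + 2 * K * ε₀ + ε₀ ^ 2 with hden
  have hden0 : 0 < den := by positivity
  -- The second constant makes the variance term 8G²/M · E/ε at most ε/2. The third gives w·b ≤ Tε
  -- once L_σ ≤ L/ε.
  refine ⟨1 / den, 16 * G ^ 2 * E, B ^ 2 * L * b / 4, by positivity, by positivity, by positivity,
    fun ε hε σ α hσ hα εest hest M T hM hT θ₀ critic hcritic => ?_⟩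
  set c := 1 / den with hc
  have hc0 : 0 < c := by positivity
  have hσ0 : 0 < σ := by rw [hσ]; positivity
  have hCσ : m.Cσ σ ≤ 1 / (1 - m.γ) + ε := by rw [hσ]; exact m.Cσ_le hK hK' hε
  have hsummable : ∀ t, Summable fun h =>
      ((m.law σ α M θ₀ critic t) h).toReal * (m.J h.1 - m.Jstar) := fun t =>
    (m.bddOn_J_sub_Jstar _ Prod.fst).summable
  rcases le_or_gt ε₀ ε with hbig | hsmall
  · refine ⟨0, Nat.zero_le _, hsummable 0, ?_⟩
    have h1 : m.law σ α M θ₀ critic 0 = PMF.pure (θ₀, []) := rfl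
    rw [h1, expect_pure]
    have h2 := (m.J_le_smoothedJ hσ0 θ₀).trans (m.smoothedJ_le_Cσ hσ0 θ₀)
    have h3 := m.Jstar_nonneg
    have h4 : 1 / (1 - m.γ) = 6 * ε₀ := by rw [hε₀]; field_simp
    change m.J θ₀ - m.Jstar ≤ 7 * ε
    linarith
  have hM0 : 0 < M := by
    have : (0 : ℝ) < M := lt_of_lt_of_le (by positivity) hM
    exact_mod_cast this
  have hT0 : (0 : ℝ) < T := lt_of_lt_of_le (by positivity) hT
  have hM0' : (0 : ℝ) < M := by exact_mod_cast hM0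
  have hcden : c * den = 1 := one_div_mul_cancel hden0.ne'
  have hc1 : c ≤ 1 := by
    rw [hc, div_le_one hden0, hden]
    have : 0 < 4 * E * F ^ 2 + 2 * K * ε₀ + ε₀ ^ 2 := by positivity
    linarith
  have hcE : c * (4 * E * F ^ 2) ≤ 1 := by
    rw [← hcden]
    refine mul_le_mul_of_nonneg_left ?_ hc0.le
    have : 0 < 1 + 2 * K * ε₀ + ε₀ ^ 2 := by positivity
    linarith
  have hcK : c * (2 * K * ε₀) ≤ 1 := by
    rw [← hcden]
    refine mul_le_mul_of_nonneg_left ?_ hc0.le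
    have : 0 < 1 + 4 * E * F ^ 2 + ε₀ ^ 2 := by positivity
    linarith
  have hcε : c * ε₀ ^ 2 ≤ 1 := by
    rw [← hcden]
    refine mul_le_mul_of_nonneg_left ?_ hc0.le
    have : 0 < 1 + 4 * E * F ^ 2 + 2 * K * ε₀ := by positivity
    linarith
  have hCσb : m.Cσ σ ≤ b - 1 := by
    have : ε₀ ≤ 1 / (1 - m.γ) := by
      rw [hε₀]
      exact one_div_le_one_div_of_le hγ (by linarith)
    have h2 : b - 1 = 1 / (1 - m.γ) + 1 / (1 - m.γ) := by rw [hb]; ring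
    linarith
  set w := B ^ 2 * m.Lσ σ / (4 * ε) with hw
  have hw0 : 0 ≤ w := by
    have := m.one_le_Lσ (A := A) hσ0
    rw [hw]; positivity
  set e := c * ε ^ 2 with he
  have he0 : 0 ≤ e := by positivity
  -- The factor σ costs one power of ε: a critic error of order ε² becomes a bias of order ε.
  have hσe : σ * e = K * c * ε := by rw [hσ, he]; field_simp
  have he1 : e ≤ 1 := by
    refine le_trans ?_ hcε
    rw [he]; gcongr
  have heε : e ≤ c * ε₀ * ε := by
    rw [he, pow_two, ← mul_assoc]; gcongr
  have hσe1 : 2 * σ * e ≤ 1 := by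
    rw [mul_assoc, hσe]
    refine le_trans ?_ hcK
    have : K * c * ε ≤ K * c * ε₀ := by gcongr
    linarith
  have hstep : ∀ t < T, expect (m.law σ α M θ₀ critic t) (fun h => m.J h.1 - m.Jstar) ≤
      7 / 2 * ε + w * (expect (m.law σ α M θ₀ critic t) (fun h => m.smoothedJ σ h.1) -
        expect (m.law σ α M θ₀ critic (t + 1)) fun h => m.smoothedJ σ h.1) := by
    intro t ht
    refine m.expect_J_sub_Jstar_le hσ0 fun h hh q hq => ?_
    have hQ : ∀ s a, |q.1 s a - m.smoothedQ σ h.1 s a| ≤ e := fun s a =>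
      ((hcritic t ht h hh).2 q hq s a).trans hest
    have hQb : ∀ s a, |q.1 s a| ≤ b := fun s a => by
      have h1 := abs_le.1 (hQ s a)
      have h2 := m.smoothedQ_nonneg hσ0 h.1 s a
      have h3 := m.smoothedQ_le hσ0 h.1 s a
      exact abs_le.2 ⟨by linarith, by linarith⟩
    have hbias : ‖m.gradMean σ h.1 q.1 - m.smoothedGrad σ h.1‖ ≤ c * ε * F := by
      refine (m.norm_gradMean_sub_le hσ0 h.1 hQ hσe1 he0).trans ?_
      have h1 : e + 4 * σ * e * m.Cσ σ ≤ c * ε * (ε₀ + 4 * K * b) := by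
        have h2 : 4 * σ * e * m.Cσ σ ≤ 4 * (K * c * ε) * b := by
          rw [mul_assoc 4 σ e, hσe]
          have : m.Cσ σ ≤ b := by linarith
          gcongr
        linarith
      have h3 : c * ε * F = Fintype.card A * (c * ε * (ε₀ + 4 * K * b)) / (1 - m.γ) := by
        rw [hF]; ring
      rw [h3]
      gcongr
    have hbM : 8 * G ^ 2 / M * (E / ε) ≤ ε / 2 := by
      rw [div_le_iff₀ (by positivity)] at hM
      rw [div_mul_div_comm, div_le_iff₀ (by positivity)]
      linarith
    have hbβ : 2 * (c * ε * F) ^ 2 * (E / ε) ≤ ε / 2 := by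
      have h3 : 2 * (c * ε * F) ^ 2 * (E / ε) = ε / 2 * (c * (c * (4 * E * F ^ 2))) := by
        field_simp; ring
      rw [h3]
      exact mul_le_of_le_one_right (by positivity) (mul_le_one₀ hc1 (by positivity) hcE)
    have hlog := m.log_card_div_mul_le hK hK' hε
    rw [← hσ] at hlog
    have h1 := m.J_sub_Jstar_le_expect_step hσ0 hε hr hρ h.1 hQb hbias hM0 hC hD hG hB hE hlog
      (by linarith)
    rwa [← hα] at h1
  have hfirst : expect (m.law σ α M θ₀ critic 0) (fun h => m.smoothedJ σ h.1) ≤ b := by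
    have h1 : m.law σ α M θ₀ critic 0 = PMF.pure (θ₀, []) := rfl
    rw [h1, expect_pure]
    have := m.smoothedJ_le_Cσ hσ0 θ₀
    change m.smoothedJ σ θ₀ ≤ b
    linarith
  have hlast : 0 ≤ expect (m.law σ α M θ₀ critic T) fun h => m.smoothedJ σ h.1 :=
    tsum_nonneg fun h => mul_nonneg ENNReal.toReal_nonneg (m.smoothedJ_nonneg hσ0 _)
  have hwb : w * b ≤ T * ε := by
    rw [div_le_iff₀ (by positivity)] at hT
    have h1 : w ≤ B ^ 2 * (L / ε) / (4 * ε) := by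
      have := hL ε hε hsmall.le
      rw [← hσ] at this
      rw [hw]; gcongr
    refine (mul_le_mul_of_nonneg_right h1 hb0.le).trans ?_
    have h2 : B ^ 2 * (L / ε) / (4 * ε) * b = B ^ 2 * L * b / 4 / ε ^ 2 := by
      field_simp
    rw [h2, div_le_iff₀ (by positivity)]
    linarith
  -- Telescoping adds one ε to the 7/2 ε of each step, for 9/2 ε in all.
  obtain ⟨t, ht, hle⟩ := exists_le_of_le_add_mul_sub (by exact_mod_cast hT0) hw0 hstep hfirst
    hlast hwb
  exact ⟨t, ht.le, hsummable t, hle.trans (by linarith)⟩
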